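/- Let $\mathring\Phi$ be an irreducible reduced finite (crystallographic) root system spanning a Euclidean space $V$, of type neither $A_1$ nor $B_n$ $(n\ge 2$; in particular type $C_n$ means $n\ge 3)$. Let $\mathring\Phi_s$ and $\mathring\Phi_\ell$ be the sets of short and long roots (both equal to $\mathring\Phi$ if there is only one root length) and let $m$ be the lacing number, i.e. the ratio of the squared lengths of a long and a short root. Let $Y$ be a finite-dimensional real vector space and let $(\Lambda_\alpha)_{\alpha\in\mathring\Phi\cup\{0\}}$ be an extension datum of type $(\mathring\Phi,Y)$: subsets of $Y$ that together span $Y$, all containing $0$, with $\Lambda_\beta-(\beta,\alpha^\vee)\Lambda_\alpha\subseteq\Lambda_{s_\alpha(\beta)}$ for $\alpha,\beta\in\mathring\Phi$. Then $\Lambda_\alpha$ depends only on the length of $\alpha\in\mathring\Phi$; write $\Lambda_s$, $\Lambda_\ell$ for its values on short and long roots. Let $\Phi$ be the set of real roots of an affine reflection system which is isomorphic to the one constructed from this datum, and identify accordingly $$\Phi=\{\alpha\oplus y:\alpha\in\mathring\Phi,\ y\in\Lambda_\alpha\}\subseteq V\oplus Y,\qquad (v_1\oplus y_1,v_2\oplus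 y_2)=(v_1,v_2).$$ A root subsystem of $\Phi$ (or of $\mathring\Phi$) is a nonempty subset $\Psi$ with $s_\alpha(\beta)\in\Psi$ for all $\alpha,\beta\in\Psi$; it is maximal if it is proper and is not contained in any other proper root subsystem. For $\Psi\subseteq\Phi$ put $Y_\alpha(\Psi)=\{y\in\Lambda_\alpha:\alpha\oplus y\in\Psi\}$ and $\mathrm{Gr}(\Psi)=\{\alpha\in\mathring\Phi: Y_\alpha(\Psi)\ne\emptyset\}$. A map $p:\mathring\Phi\to Y$, $\alpha\mapsto p_\alpha$, is called $\mathbb Z$-linear if it is the restriction of a homomorphism from the root lattice to $Y$. A maximal subgroup of a group is a maximal element among its proper subgroups, and $\langle A\rangle$ denotes the subgroup generated by $A$. **Theorem.** A subset $\Psi\subseteq\Phi$ is a maximal root subsystem of $\Phi$ if and only if (1) or (2) holds. 1. There is a $\mathbb Z$-linear $p:\mathring\Phi\to Y$ with $p_\alpha\in Y_\alpha(\Psi)$ for all $\alpha\in\mathring\Phi$ such that one of the following holds: - (i) $\Lambda_\ell\ne m\Lambda_s$ and $$\Psi=\{\alpha\oplus\Lambda_s:\alpha\in\mathring\Phi_s\}\cup\{\alpha\oplus(p_\alpha+S):\alpha\in\mathring\Phi_\ell\},$$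 where $p_\alpha+S\subseteq\Lambda_\ell$ for all $\alpha\in\mathring\Phi_\ell$ and: if $\mathring\Phi$ is not of type $C_n$, $S$ is a maximal subgroup of $\Lambda_\ell$ which contains $m\Lambda_s$; if $\mathring\Phi$ is of type $C_n$, $S$ is maximal (for inclusion) among the unions of cosets of $m\Lambda_s$ in $\Lambda_s$ which contain $m\Lambda_s$ and satisfy $p_\alpha+S\subsetneq\Lambda_\ell$ for all $\alpha\in\mathring\Phi_\ell$. - (ii) $\langle\Lambda_\ell\rangle\ne\Lambda_s$ and $$\Psi=\{\alpha\oplus(p_\alpha+H):\alpha\in\mathring\Phi_s\}\cup\{\alpha\oplus\Lambda_\ell:\alpha\in\mathring\Phi_\ell\},$$ where $H$ is a maximal subgroup of $\Lambda_s$ which contains $\Lambda_\ell$. - (iii) $$\Psi=\{\alpha\oplus(p_\alpha+H):\alpha\in\mathring\Phi_s\}\cup\{\alpha\oplus((p_\alpha+H)\cap\Lambda_\ell):\alpha\in\mathring\Phi_\ell\},$$ where $H$ is a maximal subgroup of $\Lambda_s$ with $m\Lambda_s+H=\Lambda_s$. 2. $\mathrm{Gr}(\Psi)$ is a maximal root subsystem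 of $\mathring\Phi$, $Y_\alpha(\Psi)=\Lambda_\alpha$ for all $\alpha\in\mathrm{Gr}(\Psi)$, and one of the following holds: - (a) $\mathrm{Gr}(\Psi)\ne\mathring\Phi_s$ and $\mathrm{Gr}(\Psi)\neq\mathring\Phi_\ell$; - (b) $\mathrm{Gr}(\Psi)=\mathring\Phi_s$ and $\Lambda_\ell=m\Lambda_s$; - (c) $\mathrm{Gr}(\Psi)=\mathring\Phi_\ell$ and $\langle\Lambda_\ell\rangle=\Lambda_s$. -/

import Mathlib

open scoped Pointwise InnerProductSpace

namespace AffRefl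

/-! ### Reflections and root subsystems in a space with a bilinear form -/

section Reflections

variable {X : Type*} [AddCommGroup X] [Module ℝ X]

/-- The number `(x, α^∨) = 2 (x, α) / (α, α)`, for a vector `α` with `(α, α) ≠ 0`. -/
noncomputable def coPairing (B : LinearMap.BilinForm ℝ X) (α x : X) : ℝ :=
  2 * B x α / B α α

/-- The reflection `s_α(x) = x - (x, α^∨) α`. If `(α, α) = 0`, this is the identity map. -/
noncomputable def refl (B : LinearMap.BilinForm ℝ X) (α x : X) : X :=
  x - coPairing B α x • α

/-- A root subsystem of `Φ`: a nonempty subset which is stable under its own reflections. -/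
def IsRootSubsystem (B : LinearMap.BilinForm ℝ X) (Φ Ψ : Set X) : Prop :=
  Ψ ⊆ Φ ∧ Ψ.Nonempty ∧ ∀ α ∈ Ψ, ∀ β ∈ Ψ, refl B α β ∈ Ψ

/-- A maximal root subsystem of `Φ`: a maximal element among the proper root subsystems. -/
def IsMaximalRootSubsystem (B : LinearMap.BilinForm ℝ X) (Φ Ψ : Set X) : Prop :=
  IsRootSubsystem B Φ Ψ ∧ Ψ ≠ Φ ∧
    ∀ Ψ' : Set X, IsRootSubsystem B Φ Ψ' → Ψ ⊆ Ψ' → Ψ' ≠ Φ → Ψ = Ψ'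

end Reflections

/-! ### Affine reflection systems -/

/-- An affine reflection system `(X, Δ, (·,·))`. -/
structure AffineReflectionSystem (X : Type*) [AddCommGroup X] [Module ℝ X] where
  /-- the symmetric bilinear form -/
  form : LinearMap.BilinForm ℝ X
  /-- the set `Δ` of all (real and imaginary) roots -/
  roots : Set X
  symm : ∀ x y, form x y = form y x
  zero_mem : 0 ∈ roots
  span_eq_top : Submodule.span ℝ roots = ⊤
  imaginary_radical : ∀ α ∈ roots, form α α = 0 → ∀ x, form α x = 0
  refl_image : ∀ α ∈ roots, form α α ≠ 0 → refl form α '' roots = roots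
  coPairing_int : ∀ α ∈ roots, form α α ≠ 0 → ∀ β ∈ roots, ∃ n : ℤ, coPairing form α β = n
  coPairing_finite : ∀ α ∈ roots, form α α ≠ 0 → (coPairing form α '' roots).Finite

namespace AffineReflectionSystem

variable {X X' : Type*} [AddCommGroup X] [Module ℝ X] [AddCommGroup X'] [Module ℝ X']

/-- The set `Φ = Δ^re` of real roots. -/
def real (A : AffineReflectionSystem X) : Set X := {α ∈ A.roots | A.form α α ≠ 0}

/-- Isomorphisms of affine reflection systems: linear isomorphisms which map the roots onto the
roots and are compatible with the reflections (`s_α` being the identity for imaginary `α`). -/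
structure Iso (A : AffineReflectionSystem X) (A' : AffineReflectionSystem X') where
  /-- the underlying linear isomorphism -/
  toEquiv : X ≃ₗ[ℝ] X'
  image_roots : toEquiv '' A.roots = A'.roots
  map_refl : ∀ α ∈ A.roots, ∀ x,
    toEquiv (refl A.form α x) = refl A'.form (toEquiv α) (toEquiv x)

end AffineReflectionSystem

/-! ### Finite root systems in Euclidean spaces -/

section Finite

variable {ι V N : Type*} [NormedAddCommGroup V] [InnerProductSpace ℝ V]
  [AddCommGroup N] [Module ℝ N]

/-- The reflections of the root system are orthogonal for the inner product of `V`; equivalently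
they are the maps `v ↦ v - 2 (v, α) / (α, α) α`. -/
def IsEuclidean (P : RootPairing ι ℝ V N) : Prop :=
  ∀ (i : ι) (v w : V), ⟪P.reflection i v, P.reflection i w⟫_ℝ = ⟪v, w⟫_ℝ

/-- The (indices of the) short roots of a reduced irreducible root system: the roots of minimal
length. If there is only one root length, all roots are both short and long. -/
def short (P : RootPairing ι ℝ V N) : Set ι := {i | ∀ j, ‖P.root i‖ ≤ ‖P.root j‖}

/-- The (indices of the) long roots of a reduced irreducible root system: the roots of maximal
length. -/
def long (P : RootPairing ι ℝ V N) : Set ι := {i | ∀ j, ‖P.root j‖ ≤ ‖P.root i‖}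

/-- The lacing number `m`: the ratio of the squared lengths of a long and of a short root. It is
`1` in types `A`, `D`, `E`, `2` in types `B`, `C`, `F₄`, and `3` in type `G₂`. -/
noncomputable def lacing (P : RootPairing ι ℝ V N) : ℝ :=
  (⨆ i, ‖P.root i‖ ^ 2) / (⨅ i, ‖P.root i‖ ^ 2)

/-- Type `A₁`: the roots are `±α` for a vector `α`. -/
def IsTypeA1 (P : RootPairing ι ℝ V N) : Prop := ∃ α : V, Set.range P.root = {α, -α}

/-- `e` is an orthogonal family of `n` nonzero vectors of equal length. -/
def IsOrthogonalFrame {n : ℕ} (e : Fin n → V) : Prop :=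
  ∃ c : ℝ, 0 < c ∧ ∀ i j, ⟪e i, e j⟫_ℝ = if i = j then c else 0

/-- The set of all `± e_i ± e_j` with `i ≠ j`. -/
def signedSums {n : ℕ} (e : Fin n → V) : Set V :=
  {v | ∃ i j, i ≠ j ∧ (v = e i + e j ∨ v = e i - e j ∨ v = -e i - e j)}

/-- Type `B_n`, `n ≥ 2`: up to scaling, the roots are `± ε_i` and `± ε_i ± ε_j`, `i ≠ j`. -/
def IsTypeB (P : RootPairing ι ℝ V N) : Prop :=
  ∃ (n : ℕ) (e : Fin n → V), 2 ≤ n ∧ IsOrthogonalFrame e ∧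
    Set.range P.root = {v | ∃ i, v = e i ∨ v = -e i} ∪ signedSums e

/-- Type `C_n`, `n ≥ 3`: up to scaling, the roots are `± 2ε_i` and `± ε_i ± ε_j`, `i ≠ j`. -/
def IsTypeC (P : RootPairing ι ℝ V N) : Prop :=
  ∃ (n : ℕ) (e : Fin n → V), 3 ≤ n ∧ IsOrthogonalFrame e ∧
    Set.range P.root = {v | ∃ i, v = (2 : ℝ) • e i ∨ v = -((2 : ℝ) • e i)} ∪ signedSums e

theorem IsEuclidean.coPairing_root {P : RootPairing ι ℝ V N} (hE : IsEuclidean P)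
    (i : ι) (v : V) : coPairing (innerₗ V) (P.root i) v = P.coroot' i v := by
  have h := hE i v (P.root i)
  have h0 : ⟪P.root i, P.root i⟫_ℝ ≠ 0 := by simpa using P.ne_zero i
  rw [P.reflection_apply_self, P.reflection_apply, inner_neg_right, inner_sub_left,
    real_inner_smul_left] at h
  simp only [coPairing, innerₗ_apply_apply]
  rw [div_eq_iff h0]
  linarith

end Finite

/-! ### Extension data -/

/-- An extension datum `(Λ_α)_{α ∈ Φ̊ ∪ {0}}` of type `(Φ̊, Y)`, where `Φ̊` is the set of roots of
the root system `P`. Here `Λ i` is `Λ_α` for the root `α` with index `i`. -/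
structure ExtensionDatum {ι V N : Type*} [AddCommGroup V] [Module ℝ V] [AddCommGroup N]
    [Module ℝ N] (P : RootPairing ι ℝ V N) (Y : Type*) [AddCommGroup Y] [Module ℝ Y] where
  /-- the sets `Λ_α` for roots `α` -/
  Λ : ι → Set Y
  /-- the set `Λ_0` -/
  Λ₀ : Set Y
  sub_mem : ∀ i j, ∀ y ∈ Λ j, ∀ z ∈ Λ i, y - P.pairing j i • z ∈ Λ (P.reflectionPerm i j)
  zero_mem : ∀ i, (∀ j, P.root i ≠ (2 : ℝ) • P.root j) → 0 ∈ Λ i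
  zero_mem_zero : 0 ∈ Λ₀
  nonempty : ∀ i, (Λ i).Nonempty
  span_eq_top : Submodule.span ℝ (Λ₀ ∪ ⋃ i, Λ i) = ⊤

namespace ExtensionDatum

section Construction

variable {ι V N Y : Type*} [NormedAddCommGroup V] [InnerProductSpace ℝ V]
  [AddCommGroup N] [Module ℝ N] [AddCommGroup Y] [Module ℝ Y] {P : RootPairing ι ℝ V N}

/-- The union of the sets `α ⊕ Z_α` over the roots `α` with index in `J`. -/
def graded (P : RootPairing ι ℝ V N) (J : Set ι) (Z : ι → Set Y) : Set (V × Y) :=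
  {x | ∃ i ∈ J, x.1 = P.root i ∧ x.2 ∈ Z i}

/-- The form `(v₁ ⊕ y₁, v₂ ⊕ y₂) = (v₁, v₂)` on `V ⊕ Y`. -/
noncomputable def sumForm (V Y : Type*) [NormedAddCommGroup V] [InnerProductSpace ℝ V]
    [AddCommGroup Y] [Module ℝ Y] : LinearMap.BilinForm ℝ (V × Y) :=
  (innerₗ V).compl₁₂ (LinearMap.fst ℝ V Y) (LinearMap.fst ℝ V Y)

/-- The set `Δ = ⋃_{α ∈ Φ̊ ∪ {0}} α ⊕ Λ_α`. -/
def allRoots (D : ExtensionDatum P Y) : Set (V × Y) :=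
  {x | x.1 = 0 ∧ x.2 ∈ D.Λ₀} ∪ graded P Set.univ D.Λ

theorem sumForm_apply (x y : V × Y) : sumForm V Y x y = ⟪x.1, y.1⟫_ℝ := rfl

theorem coPairing_sumForm (α x : V × Y) :
    coPairing (sumForm V Y) α x = coPairing (innerₗ V) α.1 x.1 := rfl

theorem exists_index (D : ExtensionDatum P Y) {α : V × Y} (hα : α ∈ D.allRoots)
    (h : sumForm V Y α α ≠ 0) : ∃ i, α.1 = P.root i ∧ α.2 ∈ D.Λ i := by
  rcases hα with ⟨h0, -⟩ | ⟨i, -, hi⟩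
  · exact absurd (by simp [sumForm_apply, h0]) h
  · exact ⟨i, hi⟩

theorem refl_mem (D : ExtensionDatum P Y) (hE : IsEuclidean P) {i : ι} {y : Y} (hy : y ∈ D.Λ i)
    {x : V × Y} (hx : x ∈ D.allRoots) : refl (sumForm V Y) (P.root i, y) x ∈ D.allRoots := by
  rw [refl, coPairing_sumForm, hE.coPairing_root]
  rcases hx with ⟨h0, h1⟩ | ⟨j, -, hj, hj'⟩
  · left
    simp only [Prod.fst_sub, Prod.snd_sub, Prod.smul_fst, Prod.smul_snd, Set.mem_ofPred_eq]
    rw [h0]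
    simpa using h1
  · right
    refine ⟨P.reflectionPerm i j, trivial, ?_, ?_⟩
    · rw [P.root_reflectionPerm, P.reflection_apply]
      simp [hj]
    · have := D.sub_mem i j _ hj' _ hy
      simpa [hj] using this

theorem refl_refl (hE : IsEuclidean P) (i : ι) (y : Y) (x : V × Y) :
    refl (sumForm V Y) (P.root i, y) (refl (sumForm V Y) (P.root i, y) x) = x := by
  simp only [refl, coPairing_sumForm, hE.coPairing_root, Prod.fst_sub, Prod.smul_fst, map_sub,
    map_smul, P.root_coroot'_eq_pairing, P.pairing_same]
  rw [sub_sub, ← add_smul, sub_eq_self]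
  simp only [smul_eq_mul]
  ring_nf
  simp

theorem span_allRoots [P.IsRootSystem] [P.IsCrystallographic] (D : ExtensionDatum P Y) :
    Submodule.span ℝ D.allRoots = ⊤ := by
  set S := Submodule.span ℝ D.allRoots with hS
  have hmem : ∀ i, ∀ y ∈ D.Λ i, (P.root i, y) ∈ S := fun i y hy =>
    Submodule.subset_span (Or.inr ⟨i, trivial, rfl, hy⟩)
  have hnd : ∀ i, (∀ j, P.root i ≠ (2 : ℝ) • P.root j) → (P.root i, (0 : Y)) ∈ S :=
    fun i hi => hmem i 0 (D.zero_mem i hi)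
  have hroot : ∀ i, (P.root i, (0 : Y)) ∈ S := by
    intro i
    by_cases hi : ∀ j, P.root i ≠ (2 : ℝ) • P.root j
    · exact hnd i hi
    · push Not at hi
      obtain ⟨j, hj⟩ := hi
      have : (P.root j, (0 : Y)) ∈ S := by
        refine hnd j fun k hk => ?_
        have h2 : P.pairing i i = 4 * P.pairing k i := by
          simp only [← P.root_coroot'_eq_pairing]
          rw [hj, hk, map_smul, map_smul]
          simp only [smul_eq_mul]
          ring
        rw [P.pairing_same, ← P.algebraMap_pairingIn ℤ k i] at h2
        have h3 : (2 : ℤ) = 4 * P.pairingIn ℤ k i := by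
          simp only [algebraMap_int_eq, eq_intCast] at h2
          exact_mod_cast h2
        omega
      have h4 := S.smul_mem (2 : ℝ) this
      rwa [Prod.smul_mk, ← hj, smul_zero] at h4
  have hV : ∀ v : V, (v, (0 : Y)) ∈ S := by
    intro v
    have hv : v ∈ Submodule.span ℝ (Set.range P.root) := by
      rw [RootPairing.IsRootSystem.span_root_eq_top]
      trivial
    have hle : Submodule.span ℝ (Set.range P.root) ≤ S.comap (LinearMap.inl ℝ V Y) := by
      rw [Submodule.span_le]
      rintro _ ⟨i, rfl⟩
      exact hroot i
    exact hle hv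
  have hY : ∀ y : Y, ((0 : V), y) ∈ S := by
    intro y
    have hy : y ∈ Submodule.span ℝ (D.Λ₀ ∪ ⋃ i, D.Λ i) := by
      rw [D.span_eq_top]
      trivial
    have hle : Submodule.span ℝ (D.Λ₀ ∪ ⋃ i, D.Λ i) ≤ S.comap (LinearMap.inr ℝ V Y) := by
      rw [Submodule.span_le]
      rintro z (hz | hz)
      · exact Submodule.subset_span (Or.inl ⟨rfl, hz⟩)
      · obtain ⟨i, hi⟩ := Set.mem_iUnion.1 hz
        have h5 := S.sub_mem (hmem i z hi) (hroot i)
        simpa using h5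
    exact hle hy
  refine Submodule.eq_top_iff'.2 fun x => ?_
  have h6 := S.add_mem (hV x.1) (hY x.2)
  simpa using h6

/-- The affine reflection system `(V ⊕ Y, Δ, (·,·))` constructed from an extension datum. -/
noncomputable def toSystem [Finite ι] [P.IsRootSystem] [P.IsCrystallographic]
    (D : ExtensionDatum P Y) (hE : IsEuclidean P) : AffineReflectionSystem (V × Y) where
  form := sumForm V Y
  roots := D.allRoots
  symm x y := real_inner_comm _ _
  zero_mem := Or.inl ⟨rfl, D.zero_mem_zero⟩
  span_eq_top := D.span_allRoots
  imaginary_radical α _ h x := by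
    rw [sumForm_apply, inner_self_eq_zero] at h
    rw [sumForm_apply, h, inner_zero_left]
  refl_image := by
    rintro ⟨v, y⟩ hα h
    obtain ⟨i, hi, hy⟩ := D.exists_index hα h
    simp only at hi hy
    subst hi
    ext x
    constructor
    · rintro ⟨z, hz, rfl⟩
      exact D.refl_mem hE hy hz
    · intro hx
      exact ⟨_, D.refl_mem hE hy hx, refl_refl hE i y x⟩
  coPairing_int := by
    rintro ⟨v, y⟩ hα h x hx
    obtain ⟨i, hi, hy⟩ := D.exists_index hα h
    simp only at hi hy
    subst hi
    rw [coPairing_sumForm, hE.coPairing_root]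
    rcases hx with ⟨h0, -⟩ | ⟨j, -, hj, -⟩
    · exact ⟨0, by rw [h0]; simp⟩
    · refine ⟨P.pairingIn ℤ j i, ?_⟩
      rw [hj, P.root_coroot'_eq_pairing, ← P.algebraMap_pairingIn ℤ j i]
      simp
  coPairing_finite := by
    rintro ⟨v, y⟩ hα h
    refine (((Set.finite_range P.root).union (Set.finite_singleton 0)).image
      (coPairing (innerₗ V) v)).subset ?_
    rintro _ ⟨x, hx, rfl⟩
    refine ⟨x.1, ?_, rfl⟩
    rcases hx with ⟨h0, -⟩ | ⟨j, -, hj, -⟩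
    · exact Or.inr h0
    · exact Or.inl ⟨j, hj.symm⟩

end Construction

/-! ### The data attached to a subset of the real roots -/

section Classification

variable {ι V N Y : Type*} [NormedAddCommGroup V] [InnerProductSpace ℝ V]
  [AddCommGroup N] [Module ℝ N] [AddCommGroup Y] [Module ℝ Y] {P : RootPairing ι ℝ V N}

theorem Λ_reflectionPerm [P.IsReduced] (D : ExtensionDatum P Y) (i j : ι) :
    D.Λ (P.reflectionPerm i j) = D.Λ j := by
  have h0 : ∀ i, 0 ∈ D.Λ i := fun i => D.zero_mem i fun j hj => by
    rcases RootPairing.IsReduced.eq_or_eq_neg (P := P) i j (by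
      rw [hj, LinearIndependent.pair_iff]
      intro h
      have h1 := (h 1 (-2) (by module)).1
      norm_num at h1) with h | h
    · rw [hj, two_smul, add_eq_left] at h
      exact P.ne_zero j h
    · rw [hj] at h
      have h3 : (3 : ℝ) • P.root j = 0 := by
        rw [show (3 : ℝ) = 2 + 1 by norm_num, add_smul, h, one_smul, neg_add_cancel]
      exact P.ne_zero j ((smul_eq_zero.1 h3).resolve_left (by norm_num))
  have key : ∀ j, D.Λ j ⊆ D.Λ (P.reflectionPerm i j) := fun j y hy => by
    simpa using D.sub_mem i j y hy 0 (h0 i)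
  refine Set.Subset.antisymm ?_ (key j)
  simpa using key (P.reflectionPerm i j)

/-- `Λ_α` depends only on the length of `α`, so that `Λ_s` and `Λ_ℓ` below are well defined. -/
theorem Λ_eq_of_norm_eq [Finite ι] [P.IsRootSystem] [P.IsCrystallographic] [P.IsReduced]
    [P.IsIrreducible] (D : ExtensionDatum P Y) (hE : IsEuclidean P) {i j : ι}
    (h : ‖P.root i‖ = ‖P.root j‖) : D.Λ i = D.Λ j := by
  let B : P.InvariantForm :=
    { form := innerₗ V
      symm := ⟨fun x y => real_inner_comm _ _⟩
      ne_zero := fun i => by simpa using P.ne_zero i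
      isOrthogonal_reflection := fun i x y => hE i x y }
  let T : Set ι := {k | D.Λ k = D.Λ j ∧ ‖P.root k‖ = ‖P.root j‖}
  have hT : ∀ a, ∀ k ∈ T, P.reflectionPerm a k ∈ T := by
    rintro a k ⟨h1, h2⟩
    refine ⟨by rw [D.Λ_reflectionPerm, h1], ?_⟩
    rw [← h2, P.root_reflectionPerm, ← sq_eq_sq₀ (norm_nonneg _) (norm_nonneg _),
      ← real_inner_self_eq_norm_sq, hE, real_inner_self_eq_norm_sq]
  have hspan : Submodule.span ℝ (P.root '' T) = ⊤ := by
    refine RootPairing.IsIrreducible.eq_top_of_invtSubmodule_reflection (P := P) _ (fun a => ?_) ?_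
    · rw [Module.End.mem_invtSubmodule, Submodule.span_le]
      rintro _ ⟨k, hk, rfl⟩
      exact Submodule.subset_span ⟨_, hT a k hk, P.root_reflectionPerm a k⟩
    · intro hbot
      have : P.root j ∈ Submodule.span ℝ (P.root '' T) :=
        Submodule.subset_span ⟨j, ⟨rfl, rfl⟩, rfl⟩
      rw [hbot, Submodule.mem_bot] at this
      exact P.ne_zero j this
  obtain ⟨k, hk, hki⟩ : ∃ k ∈ T, P.pairing i k ≠ 0 := by
    by_contra hcon
    push Not at hcon
    have hle : Submodule.span ℝ (P.root '' T) ≤ LinearMap.ker (innerₗ V (P.root i)) := by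
      rw [Submodule.span_le]
      rintro _ ⟨k, hk, rfl⟩
      exact (B.apply_root_root_zero_iff i k).2 (hcon k hk)
    rw [hspan] at hle
    exact P.ne_zero i (inner_self_eq_zero.1 (hle (Submodule.mem_top (x := P.root i))))
  rw [← hk.1]
  have hlen : B.form (P.root i) (P.root i) = B.form (P.root k) (P.root k) := by
    change ⟪P.root i, P.root i⟫_ℝ = ⟪P.root k, P.root k⟫_ℝ
    rw [real_inner_self_eq_norm_sq, real_inner_self_eq_norm_sq, h, hk.2]
  by_cases hik : i = k
  · rw [hik]
  by_cases hik' : P.root i = -P.root k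
  · have : i = P.reflectionPerm k k := P.root.injective (by
      rw [hik', P.root_reflectionPerm, P.reflection_apply_self])
    rw [this, D.Λ_reflectionPerm]
  have hmem := P.pairingIn_pairingIn_mem_set_of_length_eq_of_ne hlen hik hik'
  have e1 := P.algebraMap_pairingIn ℤ i k
  have e2 := P.algebraMap_pairingIn ℤ k i
  have hroot : P.root (P.reflectionPerm i (P.reflectionPerm k i)) =
      -P.root i - P.pairing i k • (P.root k - P.pairing k i • P.root i) := by
    simp only [P.root_reflectionPerm, P.reflection_apply_root, map_sub, map_smul, P.pairing_same]
    module
  have hΛ : D.Λ (P.reflectionPerm i (P.reflectionPerm k i)) = D.Λ i := by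
    rw [D.Λ_reflectionPerm, D.Λ_reflectionPerm]
  simp only [Set.mem_insert_iff, Set.mem_singleton_iff, Prod.mk.injEq] at hmem
  rcases hmem with ⟨a, b⟩ | ⟨a, b⟩ | ⟨a, b⟩
  · rw [a] at e1
    exact absurd (by simpa using e1.symm) hki
  · rw [a] at e1
    rw [b] at e2
    rw [← e1, ← e2] at hroot
    have : P.reflectionPerm i (P.reflectionPerm k i) = P.reflectionPerm k k :=
      P.root.injective (by rw [hroot, P.root_reflectionPerm, P.reflection_apply_self, map_one]; module)
    rw [← hΛ, this, D.Λ_reflectionPerm]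
  · rw [a] at e1
    rw [b] at e2
    rw [← e1, ← e2] at hroot
    have : P.reflectionPerm i (P.reflectionPerm k i) = k :=
      P.root.injective (by rw [hroot]; simp)
    rw [← hΛ, this]

/-- The set `Λ_s`: the common value of `Λ_α` for the short roots `α`. -/
def Λs (D : ExtensionDatum P Y) : Set Y := {y | ∃ i ∈ short P, y ∈ D.Λ i}

/-- The set `Λ_ℓ`: the common value of `Λ_α` for the long roots `α`. -/
def Λl (D : ExtensionDatum P Y) : Set Y := {y | ∃ i ∈ long P, y ∈ D.Λ i}

/-- `Y_α(Ψ) = {y ∈ Λ_α : α ⊕ y ∈ Ψ}`. -/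
def fiber (D : ExtensionDatum P Y) (Ψ : Set (V × Y)) (i : ι) : Set Y :=
  {y ∈ D.Λ i | (P.root i, y) ∈ Ψ}

/-- The gradient `Gr(Ψ)`, as a set of indices of roots. -/
def gradient (D : ExtensionDatum P Y) (Ψ : Set (V × Y)) : Set ι :=
  {i | (D.fiber Ψ i).Nonempty}

/-- The value `p_α` of a `ℤ`-linear function on the roots, that is, of (the restriction to the
roots of) a homomorphism from the root lattice to `Y`, at the root `α` with index `i`. -/
def val (p : P.rootSpan ℤ →ₗ[ℤ] Y) (i : ι) : Y := p (P.rootSpanMem ℤ i)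

/-- `H` is a maximal (proper) subgroup of the group with underlying set `L`. -/
def IsMaximalSubgroup (L : Set Y) (H : AddSubgroup Y) : Prop :=
  (H : Set Y) ⊂ L ∧ ∀ K : AddSubgroup Y, H ≤ K → (K : Set Y) ⊂ L → H = K

/-- `S` is a union of cosets of `m Λ_s` in `Λ_s` which contains `m Λ_s` and all whose translates
`p_α + S`, `α` long, are proper subsets of `Λ_ℓ`. -/
def IsAdmissible (D : ExtensionDatum P Y) (p : P.rootSpan ℤ →ₗ[ℤ] Y) (S : Set Y) : Prop :=
  S ⊆ D.Λs ∧ (∀ x ∈ S, x +ᵥ (lacing P • D.Λs) ⊆ S) ∧ lacing P • D.Λs ⊆ S ∧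
    ∀ i ∈ long P, val p i +ᵥ S ⊂ D.Λl

/-- The condition on `S` in the first full-gradient form: in type `C`, `S` is maximal among the
admissible unions of cosets; otherwise `S` is a maximal subgroup of `Λ_ℓ` containing `m Λ_s`. -/
def IsMaximalLongPart (D : ExtensionDatum P Y) (p : P.rootSpan ℤ →ₗ[ℤ] Y) (S : Set Y) : Prop :=
  (IsTypeC P → D.IsAdmissible p S ∧ ∀ S', D.IsAdmissible p S' → S ⊆ S' → S = S') ∧
  (¬ IsTypeC P → ∃ H : AddSubgroup Y, S = H ∧ IsMaximalSubgroup D.Λl H ∧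
    lacing P • D.Λs ⊆ (H : Set Y))

/-- First form: full short part, and a maximal long part. -/
def FullShortForm (D : ExtensionDatum P Y) (Ψ : Set (V × Y)) : Prop :=
  D.Λl ≠ lacing P • D.Λs ∧ ∃ p : P.rootSpan ℤ →ₗ[ℤ] Y, (∀ i, val p i ∈ D.fiber Ψ i) ∧
    ∃ S : Set Y, D.IsMaximalLongPart p S ∧ (∀ i ∈ long P, val p i +ᵥ S ⊆ D.Λl) ∧
      Ψ = graded P (short P) (fun _ => D.Λs) ∪ graded P (long P) (fun i => val p i +ᵥ S)

/-- Second form: full long part, and a short part given by a maximal subgroup of `Λ_s`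
containing `Λ_ℓ`. -/
def FullLongForm (D : ExtensionDatum P Y) (Ψ : Set (V × Y)) : Prop :=
  (AddSubgroup.closure D.Λl : Set Y) ≠ D.Λs ∧
    ∃ p : P.rootSpan ℤ →ₗ[ℤ] Y, (∀ i, val p i ∈ D.fiber Ψ i) ∧
    ∃ H : AddSubgroup Y, IsMaximalSubgroup D.Λs H ∧ D.Λl ⊆ (H : Set Y) ∧
      Ψ = graded P (short P) (fun i => val p i +ᵥ (H : Set Y)) ∪
        graded P (long P) (fun _ => D.Λl)

/-- Third form: both parts are cut out by a maximal subgroup `H` of `Λ_s` with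
`m Λ_s + H = Λ_s`. -/
def MixedForm (D : ExtensionDatum P Y) (Ψ : Set (V × Y)) : Prop :=
  ∃ p : P.rootSpan ℤ →ₗ[ℤ] Y, (∀ i, val p i ∈ D.fiber Ψ i) ∧
    ∃ H : AddSubgroup Y, IsMaximalSubgroup D.Λs H ∧ lacing P • D.Λs + (H : Set Y) = D.Λs ∧
      Ψ = graded P (short P) (fun i => val p i +ᵥ (H : Set Y)) ∪
        graded P (long P) (fun i => (val p i +ᵥ (H : Set Y)) ∩ D.Λl)

/-- `Ψ` is the lift of a maximal root subsystem of the finite root system: `Gr(Ψ)` is a maximal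
root subsystem of `Φ̊`, and `Y_α(Ψ) = Λ_α` for all `α ∈ Gr(Ψ)`. -/
def IsMaximalLift (D : ExtensionDatum P Y) (Ψ : Set (V × Y)) : Prop :=
  IsMaximalRootSubsystem (innerₗ V) (Set.range P.root) (P.root '' D.gradient Ψ) ∧
    ∀ i ∈ D.gradient Ψ, D.fiber Ψ i = D.Λ i

end Classification

end ExtensionDatum

end AffRefl

/-! The classification splits according to the gradient of `Ψ`, after an isomorphism has replaced
the given system by the one built from the datum.

If the gradient is proper, it lies in a maximal subsystem of the finite system. The lift of the
latter is a proper subsystem containing `Ψ`, hence equals `Ψ` (`isMaximalLift_of_isMaximal`).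

If the gradient is full, choosing points of `Ψ` over the simple roots and reflecting shows that `Ψ`
contains the graph of a `ℤ`-linear map `p` (`exists_val_mem`). Shifted by `p`, the fibres of any
subsystem containing this graph form an extension datum again. They amount to a pair `(H, S)`: a
group `H` over the short roots and a set `S` over the long ones, with `0 ∈ S ⊆ H` and `S + mH ⊆ S`,
where `S` is a group outside type `C` (`exists_isLengthPair`). Conversely, every such pair gives a
subsystem (`refl_mem_pairSet`). Thus maximal subsystems with full gradient are maximal proper pairs
below the pair `(G, L)` of the whole system. Either `H = G` and `S` is maximal, or `H` is a maximal
subgroup and `S = L ∩ H`. The second case splits into `mG ⊆ H`, which forces `S = L`, and `mG + H =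
G` (`isMaximalLengthPair_iff`).

The group structure on the fibres comes from two roots of equal length at 120 degrees. If no two
short roots form this angle, the short roots are an orthogonal frame up to signs, and the
coordinates of the other roots lead to type `A₁` or `B`. For long roots the outcome is `A₁`, `B` or
`C` (`exists_short_short`, `exists_long_long`).

It remains to decide which lifts are maximal. A larger proper subsystem must have full gradient, so
it is given by a pair. If the lifted gradient contains both short and long roots, this pair is
everything. If it consists of the short roots only, the obstruction is `(Λ_s, mΛ_s)`; if of the long
roots only, it is `(⟨Λ_ℓ⟩, Λ_ℓ)`. These are improper exactly under the stated equalities. -/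

namespace AffRefl

/-! ### Orthogonal frames and signed sums -/

section Frames

variable {V : Type*} [NormedAddCommGroup V] [InnerProductSpace ℝ V]

theorem refl_innerₗ (a x : V) : refl (innerₗ V) a x = x - (2 * ⟪x, a⟫_ℝ / ⟪a, a⟫_ℝ) • a := rfl

theorem refl_neg (a x : V) : refl (innerₗ V) (-a) x = refl (innerₗ V) a x := by
  simp [refl_innerₗ, neg_div]

section

variable {n : ℕ} {u : Fin n → V} {c : ℝ} (hc : 0 < c)
  (hu : ∀ i j, ⟪u i, u j⟫_ℝ = if i = j then c else 0)
include hc hu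

/-- Coordinates with respect to a spanning orthogonal frame. -/
theorem frame_expansion (hspan : Submodule.span ℝ (Set.range u) = ⊤) (v : V) :
    v = ∑ a, (⟪v, u a⟫_ℝ / c) • u a := by
  have hv : v ∈ Submodule.span ℝ (Set.range u) := hspan ▸ Submodule.mem_top
  induction hv using Submodule.span_induction with
  | mem x hx =>
    obtain ⟨b, rfl⟩ := hx
    simp [hu, hc.ne', ite_div, ite_smul]
  | zero => simp
  | add x y _ _ hx hy =>
    conv_lhs => rw [hx, hy]
    rw [← Finset.sum_add_distrib]
    refine Finset.sum_congr rfl fun a _ => ?_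
    rw [inner_add_left, add_div, add_smul]
  | smul r x _ hx =>
    conv_lhs => rw [hx, Finset.smul_sum]
    refine Finset.sum_congr rfl fun a _ => ?_
    rw [real_inner_smul_left, mul_div_assoc, smul_smul]

/-- Applied to a root of the other length, this counts the nonzero coordinates in terms of the ratio
of squared lengths. -/
theorem frame_parseval (hspan : Submodule.span ℝ (Set.range u) = ⊤) (v : V) :
    ⟪v, v⟫_ℝ * c = ∑ a, ⟪v, u a⟫_ℝ ^ 2 := by
  conv_lhs => enter [1, 3]; rw [frame_expansion hc hu hspan v]
  simp only [inner_sum, real_inner_smul_right, Finset.sum_mul]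
  refine Finset.sum_congr rfl fun a _ => ?_
  field_simp

/-- A vector whose coordinates are `0` or `±1`, two of them being nonzero, is a signed sum. -/
theorem mem_signedSums (hspan : Submodule.span ℝ (Set.range u) = ⊤) {v : V} {z : Fin n → ℤ}
    (hz : ∀ a, z a = 0 ∨ z a = 1 ∨ z a = -1) (hv : ∀ a, ⟪v, u a⟫_ℝ = z a * c)
    (hN : ∑ a, z a ^ 2 = 2) : v ∈ signedSums u := by
  -- Each square is `0` or `1`, so `hN` counts the nonzero coordinates.
  have hcard : (Finset.univ.filter fun a => z a ≠ 0).card = 2 := by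
    have h1 : ∀ a, z a ^ 2 = if z a ≠ 0 then 1 else 0 := fun a => by
      rcases hz a with h | h | h <;> simp [h]
    have h2 : ((Finset.univ.filter fun a => z a ≠ 0).card : ℤ) = 2 := by
      rw [← hN, Finset.card_filter]
      push_cast
      exact Finset.sum_congr rfl fun a _ => (h1 a).symm
    exact_mod_cast h2
  obtain ⟨a, b, hab, hs⟩ := Finset.card_eq_two.1 hcard
  have h0 : ∀ x, z x ≠ 0 ↔ x = a ∨ x = b := fun x => by
    have := Finset.ext_iff.1 hs x
    simpa using this
  have hexp : v = (z a : ℝ) • u a + (z b : ℝ) • u b := by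
    conv_lhs => rw [frame_expansion hc hu hspan v]
    rw [← Finset.sum_pair (f := fun x => (z x : ℝ) • u x) hab]
    symm
    refine Finset.sum_subset_zero_on_sdiff (Finset.subset_univ _) (fun x hx => ?_) fun x _ => ?_
    · have hx' : z x = 0 := by
        by_contra h
        rw [← ne_eq, h0] at h
        simp at hx
        tauto
      simp [hv, hx']
    · rw [hv, mul_div_assoc, div_self hc.ne', mul_one]
  have ha := (hz a).resolve_left ((h0 a).2 (Or.inl rfl))
  have hb := (hz b).resolve_left ((h0 b).2 (Or.inr rfl))
  rcases ha with ha | ha <;> rcases hb with hb | hb <;> rw [ha, hb] at hexp <;>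
    simp only [Int.cast_one, Int.cast_neg, one_smul, neg_smul] at hexp
  · exact ⟨a, b, hab, Or.inl hexp⟩
  · exact ⟨a, b, hab, Or.inr (Or.inl (by rw [hexp]; abel))⟩
  · exact ⟨b, a, hab.symm, Or.inr (Or.inl (by rw [hexp]; abel))⟩
  · exact ⟨a, b, hab, Or.inr (Or.inr (by rw [hexp]; abel))⟩

theorem refl_smul_frame {t : ℝ} (ht : t ≠ 0) (k j : Fin n) :
    refl (innerₗ V) (t • u k) (u j) = if j = k then -u j else u j := by
  simp only [refl_innerₗ, real_inner_smul_left, real_inner_smul_right, hu, if_true]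
  split_ifs with h
  · subst h
    have : 2 * (t * c) / (t * (t * c)) * t = 2 := by
      field_simp
    rw [smul_smul, this]
    module
  · simp

omit hc in
theorem refl_frame_sub {k l : Fin n} (hkl : k ≠ l) (x : V) :
    refl (innerₗ V) (u k - u l) x = x - ((⟪x, u k⟫_ℝ - ⟪x, u l⟫_ℝ) / c) • (u k - u l) := by
  simp only [refl_innerₗ, inner_sub_left, inner_sub_right, hu, if_true, if_neg hkl, if_neg hkl.symm]
  rw [sub_zero, zero_sub, sub_neg_eq_add, ← two_mul, mul_div_mul_left _ _ two_ne_zero]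

omit hc in
theorem refl_frame_add {k l : Fin n} (hkl : k ≠ l) (x : V) :
    refl (innerₗ V) (u k + u l) x = x - ((⟪x, u k⟫_ℝ + ⟪x, u l⟫_ℝ) / c) • (u k + u l) := by
  simp only [refl_innerₗ, inner_add_left, inner_add_right, hu, if_true, if_neg hkl, if_neg hkl.symm]
  rw [add_zero, zero_add, ← two_mul, mul_div_mul_left _ _ two_ne_zero]

/-- If an irreducible reflection-stable set consists of multiples `±t u_i` of an orthogonal frame
and of signed sums, then it contains all signed sums. -/
theorem signedSums_subset {t : ℝ} (ht : t ≠ 0) {R : Set V}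
    (hR : ∀ a ∈ R, ∀ x ∈ R, refl (innerₗ V) a x ∈ R)
    (hirr : ∀ T ⊆ R, T.Nonempty → (∀ a ∈ R, ∀ x ∈ T, refl (innerₗ V) a x ∈ T) →
      ∀ v ≠ 0, ∃ x ∈ T, ⟪v, x⟫_ℝ ≠ 0)
    (htu : ∀ a, t • u a ∈ R)
    (hcover : ∀ x ∈ R, (∃ a, x = t • u a ∨ x = -(t • u a)) ∨ x ∈ signedSums u) :
    signedSums u ⊆ R := by
  have hneg : ∀ x ∈ R, x ≠ 0 → -x ∈ R := fun x hx h0 => by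
    have := hR x hx x hx
    rw [refl_innerₗ, mul_div_assoc, div_self (by simpa using h0)] at this
    convert! this using 1
    module
  have hsm : ∀ a : V, ∀ r : ℝ, ∀ x, refl (innerₗ V) a (r • x) = r • refl (innerₗ V) a x := by
    intro a r x
    simp only [refl_innerₗ, real_inner_smul_left, smul_sub, smul_smul]
    congr 2
    ring
  have hadd : ∀ a x y : V,
      refl (innerₗ V) a (x + y) = refl (innerₗ V) a x + refl (innerₗ V) a y := by
    intro a x y
    simp only [refl_innerₗ, inner_add_left, mul_add, add_div]
    module
  have hnegr : ∀ a x : V, refl (innerₗ V) a (-x) = - refl (innerₗ V) a x := by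
    intro a x
    have := hsm a (-1) x
    simpa using this
  have hu0 : ∀ a, u a ≠ 0 := fun a h => by
    have := hu a a
    simp [h] at this
    exact hc.ne this
  -- Reflections in the `t • u k` flip one sign at a time, so a single signed sum on `{k, l}` brings
  -- along the others; it suffices to track which sums `u k + u l` occur.
  have hf1 : ∀ k l, k ≠ l → ∀ x ∈ R, (x = u k + u l ∨ x = u k - u l ∨ x = -u k - u l) →
      u k + u l ∈ R := by
    intro k l hkl x hx h
    rcases h with rfl | rfl | rfl
    · exact hx
    · have := hR _ (htu l) _ hx
      rw [sub_eq_add_neg, hadd, hnegr, refl_smul_frame hc hu ht, refl_smul_frame hc hu ht] at this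
      simpa [hkl] using this
    · have h1 := hR _ (htu k) _ (hR _ (htu l) _ hx)
      rw [sub_eq_add_neg, hadd, hnegr, hnegr, refl_smul_frame hc hu ht,
        refl_smul_frame hc hu ht, if_neg hkl, if_pos rfl, neg_neg, hadd, hnegr,
        refl_smul_frame hc hu ht, refl_smul_frame hc hu ht, if_neg hkl.symm, if_pos rfl,
        neg_neg] at h1
      exact h1
  have hf2 : ∀ k l, k ≠ l → u k + u l ∈ R → u k - u l ∈ R := by
    intro k l hkl h
    have := hR _ (htu l) _ h
    rw [hadd, refl_smul_frame hc hu ht, refl_smul_frame hc hu ht] at this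
    simpa [hkl, sub_eq_add_neg] using this
  -- The reflection in `u k - u l` exchanges `u k` and `u l`, which makes the relation `u k + u l ∈
  -- R` transitive.
  have htrans : ∀ a k l, a ≠ k → k ≠ l → a ≠ l → u a + u k ∈ R → u k + u l ∈ R →
      u a + u l ∈ R := by
    intro a k l hak hkl hal h1 h2
    have := hR _ (hf2 k l hkl h2) _ h1
    rw [refl_frame_sub hu hkl] at this
    simp only [inner_add_left, hu, if_neg hak, if_pos, if_neg hal, if_neg hkl, zero_add, sub_zero,
      add_zero, div_self hc.ne', one_smul] at this
    convert! this using 1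
    abel
  have main : ∀ a b, a ≠ b → u a + u b ∈ R := by
    intro a b hab
    -- `T` consists of the multiples `±t u_j` with `j` in the class of `a` under this relation. It
    -- is stable under all reflections, so by irreducibility no nonzero vector is orthogonal to it.
    let T : Set V := {x | ∃ j, (x = t • u j ∨ x = -(t • u j)) ∧ (j = a ∨ (a ≠ j ∧ u a + u j ∈ R))}
    have hTneg : ∀ x ∈ T, -x ∈ T := by
      rintro x ⟨j, hx | hx, hj⟩
      · exact ⟨j, Or.inr (by rw [hx]), hj⟩
      · exact ⟨j, Or.inl (by rw [hx, neg_neg]), hj⟩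
    have hpair : ∀ k l, k ≠ l → u k + u l ∈ R → ∀ r, (r = u k + u l ∨ r = u k - u l) →
        ∀ j, (j = a ∨ (a ≠ j ∧ u a + u j ∈ R)) → refl (innerₗ V) r (t • u j) ∈ T := by
      intro k l hkl hmem r hr j hj
      have step : ∀ p q, p ≠ q → u p + u q ∈ R → (p = a ∨ (a ≠ p ∧ u a + u p ∈ R)) →
          (q = a ∨ (a ≠ q ∧ u a + u q ∈ R)) := by
        intro p q hpq hm hp
        by_cases hqa : q = a
        · exact Or.inl hqa
        right
        refine ⟨Ne.symm hqa, ?_⟩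
        rcases hp with rfl | ⟨hp1, hp2⟩
        · exact hm
        · exact htrans a p q hp1 hpq (Ne.symm hqa) hp2 hm
      rw [hsm]
      rcases hr with rfl | rfl
      · rw [refl_frame_add hu hkl]
        by_cases hjk : j = k
        · subst hjk
          refine ⟨l, Or.inr ?_, step j l hkl hmem hj⟩
          simp only [hu, if_pos, if_neg hkl, add_zero, div_self hc.ne']
          module
        by_cases hjl : j = l
        · subst hjl
          refine ⟨k, Or.inr ?_, step j k hkl.symm (by rwa [add_comm]) hj⟩
          simp only [hu, if_pos, if_neg hkl.symm, zero_add, div_self hc.ne']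
          module
        · refine ⟨j, Or.inl ?_, hj⟩
          simp [hu, hjk, hjl]
      · rw [refl_frame_sub hu hkl]
        by_cases hjk : j = k
        · subst hjk
          refine ⟨l, Or.inl ?_, step j l hkl hmem hj⟩
          simp only [hu, if_pos, if_neg hkl, sub_zero, div_self hc.ne']
          module
        by_cases hjl : j = l
        · subst hjl
          refine ⟨k, Or.inl ?_, step j k hkl.symm (by rwa [add_comm]) hj⟩
          simp only [hu, if_pos, if_neg hkl.symm, zero_sub, neg_div, div_self hc.ne']
          module
        · refine ⟨j, Or.inl ?_, hj⟩
          simp [hu, hjk, hjl]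
    have hT1 : ∀ r ∈ R, ∀ j, (j = a ∨ (a ≠ j ∧ u a + u j ∈ R)) →
        refl (innerₗ V) r (t • u j) ∈ T := by
      intro r hr j hj
      rcases hcover r hr with ⟨k, hk⟩ | ⟨k, l, hkl, hk⟩
      · have : refl (innerₗ V) r (t • u j) = t • (if j = k then -u j else u j) := by
          rcases hk with rfl | rfl
          · rw [hsm, refl_smul_frame hc hu ht]
          · rw [refl_neg, hsm, refl_smul_frame hc hu ht]
        rw [this]
        split_ifs
        · exact ⟨j, Or.inr (by simp), hj⟩
        · exact ⟨j, Or.inl rfl, hj⟩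
      · have hmem := hf1 k l hkl r hr hk
        rcases hk with hk | hk | hk
        · exact hpair k l hkl hmem r (Or.inl hk) j hj
        · exact hpair k l hkl hmem r (Or.inr hk) j hj
        · have : r = -(u k + u l) := by rw [hk]; abel
          rw [this, refl_neg]
          exact hpair k l hkl hmem _ (Or.inl rfl) j hj
    obtain ⟨x, ⟨j, hx, hj⟩, hne⟩ := hirr T
      (by
        rintro x ⟨j, rfl | rfl, -⟩
        · exact htu j
        · exact hneg _ (htu j) (smul_ne_zero ht (hu0 j)))
      ⟨t • u a, a, Or.inl rfl, Or.inl rfl⟩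
      (by
        rintro r hr x ⟨j, rfl | rfl, hj⟩
        · exact hT1 r hr j hj
        · rw [hnegr]
          exact hTneg _ (hT1 r hr j hj))
      (u b) (hu0 b)
    -- Among the elements `±t u_j`, only those with `j = b` are not orthogonal to `u b`.
    have hbj : b = j := by
      by_contra h
      rcases hx with rfl | rfl <;> simp [real_inner_smul_right, hu, h] at hne
    subst hbj
    rcases hj with h | h
    · exact absurd h.symm hab
    · exact h.2
  rintro x ⟨k, l, hkl, rfl | rfl | rfl⟩
  · exact main k l hkl
  · exact hf2 k l hkl (main k l hkl)
  · have h0 : u k + u l ≠ 0 := fun h => by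
      have : ⟪u k + u l, u k⟫_ℝ = 0 := by rw [h, inner_zero_left]
      rw [inner_add_left, hu, hu, if_pos rfl, if_neg hkl.symm, add_zero] at this
      exact hc.ne' this
    have := hneg _ (main k l hkl) h0
    convert! this using 1
    abel

end

end Frames

/-! ### Short and long roots of a Euclidean root system -/

section FiniteRootSystems

variable {ι V N : Type*} [NormedAddCommGroup V] [InnerProductSpace ℝ V]
  [AddCommGroup N] [Module ℝ N] {P : RootPairing ι ℝ V N}

namespace IsEuclidean

/-- The inner product as an invariant form of a Euclidean root system. -/
noncomputable def invariantForm (hE : IsEuclidean P) : P.InvariantForm where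
  form := innerₗ V
  symm := ⟨fun x y => real_inner_comm _ _⟩
  ne_zero i := by simpa using P.ne_zero i
  isOrthogonal_reflection i x y := hE i x y

theorem two_inner (hE : IsEuclidean P) (i j : ι) :
    2 * ⟪P.root i, P.root j⟫_ℝ = P.pairing i j * ⟪P.root j, P.root j⟫_ℝ :=
  hE.invariantForm.two_mul_apply_root_root i j

theorem pairing_swap (hE : IsEuclidean P) (i j : ι) :
    P.pairing j i * ⟪P.root i, P.root i⟫_ℝ = P.pairing i j * ⟪P.root j, P.root j⟫_ℝ :=
  hE.invariantForm.pairing_mul_eq_pairing_mul_swap i j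

theorem inner_eq_zero_iff (hE : IsEuclidean P) (i j : ι) :
    ⟪P.root i, P.root j⟫_ℝ = 0 ↔ P.pairing i j = 0 :=
  hE.invariantForm.apply_root_root_zero_iff i j

theorem refl_root (hE : IsEuclidean P) (i : ι) (v : V) :
    refl (innerₗ V) (P.root i) v = P.reflection i v := by
  rw [refl, hE.coPairing_root, P.reflection_apply]

theorem refl_root_root (hE : IsEuclidean P) (i j : ι) :
    refl (innerₗ V) (P.root i) (P.root j) = P.root (P.reflectionPerm i j) := by
  rw [hE.refl_root, P.root_reflectionPerm]

theorem norm_reflectionPerm (hE : IsEuclidean P) (i j : ι) :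
    ‖P.root (P.reflectionPerm i j)‖ = ‖P.root j‖ := by
  rw [P.root_reflectionPerm, ← sq_eq_sq₀ (norm_nonneg _) (norm_nonneg _),
    ← real_inner_self_eq_norm_sq, hE, real_inner_self_eq_norm_sq]

theorem reflectionPerm_mem_short (hE : IsEuclidean P) (i : ι) {j : ι} :
    P.reflectionPerm i j ∈ short P ↔ j ∈ short P := by
  simp only [short, Set.mem_ofPred_eq, hE.norm_reflectionPerm]

theorem reflectionPerm_mem_long (hE : IsEuclidean P) (i : ι) {j : ι} :
    P.reflectionPerm i j ∈ long P ↔ j ∈ long P := by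
  simp only [long, Set.mem_ofPred_eq, hE.norm_reflectionPerm]

/-- The span is a nonzero subspace invariant under all reflections, so irreducibility applies. -/
theorem span_eq_top_of_refl_mem [P.IsIrreducible] (hE : IsEuclidean P) {T : Set V}
    (hT : T ⊆ Set.range P.root) (hne : T.Nonempty)
    (h : ∀ a ∈ Set.range P.root, ∀ x ∈ T, refl (innerₗ V) a x ∈ T) :
    Submodule.span ℝ T = ⊤ := by
  refine RootPairing.IsIrreducible.eq_top_of_invtSubmodule_reflection (P := P) _ (fun a => ?_) ?_
  · rw [Module.End.mem_invtSubmodule, Submodule.span_le]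
    intro x hx
    refine Submodule.subset_span ?_
    have := h _ ⟨a, rfl⟩ x hx
    rwa [hE.refl_root] at this
  · intro hbot
    obtain ⟨x, hx⟩ := hne
    obtain ⟨i, rfl⟩ := hT hx
    have h1 : P.root i ∈ Submodule.span ℝ T := Submodule.subset_span hx
    rw [hbot, Submodule.mem_bot] at h1
    exact P.ne_zero i h1

theorem exists_inner_ne_zero [P.IsIrreducible] (hE : IsEuclidean P) {T : Set V}
    (hT : T ⊆ Set.range P.root) (hne : T.Nonempty)
    (h : ∀ a ∈ Set.range P.root, ∀ x ∈ T, refl (innerₗ V) a x ∈ T) {v : V} (hv : v ≠ 0) :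
    ∃ x ∈ T, ⟪v, x⟫_ℝ ≠ 0 := by
  by_contra! hcon
  have hle : Submodule.span ℝ T ≤ LinearMap.ker (innerₗ V v) := Submodule.span_le.2 hcon
  rw [hE.span_eq_top_of_refl_mem hT hne h] at hle
  exact hv (inner_self_eq_zero.1 (hle (Submodule.mem_top (x := v))))

/-- A frame `u` such that the `t u_i` are roots, and such that all other roots are signed sums of
`u`, describes the root system completely. -/
theorem range_root_eq_of_frame [P.IsIrreducible] (hE : IsEuclidean P)
    {n : ℕ} {u : Fin n → V} {c t : ℝ} (hc : 0 < c)
    (hu : ∀ i j, ⟪u i, u j⟫_ℝ = if i = j then c else 0) (ht : t ≠ 0)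
    (htu : ∀ a, t • u a ∈ Set.range P.root)
    (hcover : ∀ x ∈ Set.range P.root,
      (∃ a, x = t • u a ∨ x = -(t • u a)) ∨ x ∈ signedSums u) :
    Set.range P.root = {v | ∃ a, v = t • u a ∨ v = -(t • u a)} ∪ signedSums u := by
  refine Set.Subset.antisymm hcover (Set.union_subset ?_ ?_)
  · rintro x ⟨a, rfl | rfl⟩
    · exact htu a
    · obtain ⟨i, hi⟩ := htu a
      exact ⟨P.reflectionPerm i i, by
        rw [P.root_reflectionPerm, P.reflection_apply_self, hi]⟩
  · refine signedSums_subset hc hu ht ?_ ?_ htu hcover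
    · rintro _ ⟨i, rfl⟩ _ ⟨j, rfl⟩
      exact ⟨_, (hE.refl_root_root i j).symm⟩
    · intro T hT hne h v hv
      exact hE.exists_inner_ne_zero hT hne h hv

end IsEuclidean

theorem nonempty_index (P : RootPairing ι ℝ V N) [P.IsRootSystem] [P.IsIrreducible] :
    Nonempty ι := by
  by_contra h
  rw [not_nonempty_iff] at h
  have h1 : Submodule.span ℝ (Set.range P.root) = ⊤ := RootPairing.IsRootSystem.span_root_eq_top
  have := RootPairing.IsIrreducible.nontrivial P
  rw [Set.range_eq_empty, Submodule.span_empty] at h1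
  exact bot_ne_top h1

theorem inner_root_pos (P : RootPairing ι ℝ V N) (i : ι) : 0 < ⟪P.root i, P.root i⟫_ℝ :=
  real_inner_self_pos.2 (P.ne_zero i)

theorem inner_root_le_iff (P : RootPairing ι ℝ V N) (i j : ι) :
    ⟪P.root i, P.root i⟫_ℝ ≤ ⟪P.root j, P.root j⟫_ℝ ↔ ‖P.root i‖ ≤ ‖P.root j‖ := by
  rw [real_inner_self_eq_norm_sq, real_inner_self_eq_norm_sq,
    sq_le_sq₀ (norm_nonneg _) (norm_nonneg _)]

theorem norm_eq_of_mem_short {i j : ι} (hi : i ∈ short P) (hj : j ∈ short P) :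
    ‖P.root i‖ = ‖P.root j‖ :=
  le_antisymm (hi j) (hj i)

theorem norm_eq_of_mem_long {i j : ι} (hi : i ∈ long P) (hj : j ∈ long P) :
    ‖P.root i‖ = ‖P.root j‖ :=
  le_antisymm (hj i) (hi j)

theorem short_nonempty [Finite ι] (P : RootPairing ι ℝ V N) [P.IsRootSystem] [P.IsIrreducible] :
    (short P).Nonempty := by
  have := nonempty_index P
  exact Finite.exists_min fun i => ‖P.root i‖

theorem long_nonempty [Finite ι] (P : RootPairing ι ℝ V N) [P.IsRootSystem] [P.IsIrreducible] :
    (long P).Nonempty := by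
  have := nonempty_index P
  exact Finite.exists_max fun i => ‖P.root i‖

theorem inner_long_eq_lacing_mul [Finite ι] {i j : ι} (hi : i ∈ short P) (hj : j ∈ long P) :
    ⟪P.root j, P.root j⟫_ℝ = lacing P * ⟪P.root i, P.root i⟫_ℝ := by
  have : Nonempty ι := ⟨i⟩
  have h1 : ⨆ k, ‖P.root k‖ ^ 2 = ‖P.root j‖ ^ 2 :=
    le_antisymm (ciSup_le fun k => pow_le_pow_left₀ (norm_nonneg _) (hj k) 2)
      (le_ciSup (f := fun k => ‖P.root k‖ ^ 2) (Set.finite_range _).bddAbove j)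
  have h2 : ⨅ k, ‖P.root k‖ ^ 2 = ‖P.root i‖ ^ 2 :=
    le_antisymm (ciInf_le (f := fun k => ‖P.root k‖ ^ 2) (Set.finite_range _).bddBelow i)
      (le_ciInf fun k => pow_le_pow_left₀ (norm_nonneg _) (hi k) 2)
  have h3 : ‖P.root i‖ ^ 2 ≠ 0 := pow_ne_zero 2 (norm_ne_zero_iff.2 (P.ne_zero i))
  rw [lacing, h1, h2, real_inner_self_eq_norm_sq, real_inner_self_eq_norm_sq,
    div_mul_cancel₀ _ h3]

theorem lacing_eq_one_of_mem [Finite ι] {i : ι} (hi : i ∈ short P) (hj : i ∈ long P) :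
    lacing P = 1 := by
  have := inner_long_eq_lacing_mul hi hj
  exact (mul_eq_right₀ (inner_root_pos P i).ne').1 this.symm

/-- Both pairings arise from the same inner product, divided by the squared length of one root or
the other. This is how `m` enters the conditions on the fibres. -/
theorem IsEuclidean.pairing_eq_lacing_mul [Finite ι] (hE : IsEuclidean P) {i j : ι}
    (hi : i ∈ short P) (hj : j ∈ long P) : P.pairing j i = lacing P * P.pairing i j := by
  have h := hE.pairing_swap i j
  rw [inner_long_eq_lacing_mul hi hj, ← mul_assoc, mul_left_inj' (inner_root_pos P i).ne'] at h
  rw [h, mul_comm]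

section Crystallographic

variable [Finite ι] [P.IsRootSystem] [P.IsCrystallographic] [P.IsReduced] [P.IsIrreducible]

/-- At most two squared lengths occur, so there is no room for one strictly between the minimum and
the maximum. -/
theorem IsEuclidean.mem_short_or_mem_long (hE : IsEuclidean P) (i : ι) :
    i ∈ short P ∨ i ∈ long P := by
  have := nonempty_index P
  by_contra! h
  simp only [short, long, Set.mem_ofPred_eq, ← inner_root_le_iff] at h
  push Not at h
  obtain ⟨⟨a, ha⟩, b, hb⟩ := h
  obtain ⟨x, y, hxy⟩ := hE.invariantForm.exists_apply_eq_or
  have e : ∀ k, hE.invariantForm.form (P.root k) (P.root k) = ⟪P.root k, P.root k⟫_ℝ :=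
    fun _ => rfl
  simp only [e] at hxy
  rcases hxy a with h1 | h1 <;> rcases hxy b with h2 | h2 <;> rcases hxy i with h3 | h3 <;>
    linarith

theorem IsEuclidean.exists_int_eq_lacing (hE : IsEuclidean P) :
    ∃ m : ℤ, (m : ℝ) = lacing P ∧ (m = 1 ∨ m = 2 ∨ m = 3) := by
  obtain ⟨i, hi⟩ := short_nonempty P
  obtain ⟨j, hj⟩ := long_nonempty P
  have e : ∀ k, hE.invariantForm.form (P.root k) (P.root k) = ⟪P.root k, P.root k⟫_ℝ :=
    fun _ => rfl
  have h := hE.invariantForm.apply_eq_or j i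
  simp only [e] at h
  have h0 := inner_root_pos P i
  have h0' := inner_root_pos P j
  have hle := (inner_root_le_iff P i j).2 (hi j)
  have hl := inner_long_eq_lacing_mul hi hj
  have key : ∀ r : ℝ, ⟪P.root j, P.root j⟫_ℝ = r * ⟪P.root i, P.root i⟫_ℝ → r = lacing P :=
    fun r hr => mul_right_cancel₀ h0.ne' (hr.symm.trans hl)
  rcases h with h | h | h | h | h
  · exact ⟨1, by push_cast; exact key 1 (by rw [h, one_mul]), by simp⟩
  · exact ⟨2, by push_cast; exact key 2 h, by simp⟩
  · exact ⟨3, by push_cast; exact key 3 h, by simp⟩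
  · linarith
  · linarith

omit [P.IsRootSystem] [P.IsReduced] in
/-- A reflection-stable set of roots of one length either contains two roots at an
angle of `120` degrees, or is an orthogonal frame up to signs. -/
theorem IsEuclidean.exists_pairing_eq_neg_one_or_frame (hE : IsEuclidean P) {J : Set ι}
    (hne : J.Nonempty) (hJ : ∀ a, ∀ k ∈ J, P.reflectionPerm a k ∈ J)
    (hlen : ∀ i ∈ J, ∀ j ∈ J, ‖P.root i‖ = ‖P.root j‖) :
    (∃ i ∈ J, ∃ j ∈ J, P.pairing i j = -1 ∧ P.pairing j i = -1) ∨
    ∃ (n : ℕ) (f : Fin n → ι), 0 < n ∧ (∀ a, f a ∈ J) ∧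
      (∀ a b, a ≠ b → ⟪P.root (f a), P.root (f b)⟫_ℝ = 0) ∧
      (∀ i ∈ J, ∃ a, P.root i = P.root (f a) ∨ P.root i = -P.root (f a)) ∧
      Submodule.span ℝ (Set.range fun a => P.root (f a)) = ⊤ := by
  by_cases hex : ∃ i ∈ J, ∃ j ∈ J, P.pairing i j = -1 ∧ P.pairing j i = -1
  · exact Or.inl hex
  right
  -- Non-proportional roots of equal length have pairings `(0, 0)`, `(1, 1)` or `(-1, -1)`. Negating
  -- one root turns the second case into the third, which is excluded here.
  have horth : ∀ i ∈ J, ∀ j ∈ J, ⟪P.root i, P.root j⟫_ℝ ≠ 0 →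
      P.root i = P.root j ∨ P.root i = -P.root j := by
    intro i hi j hj h0
    by_contra! hcon
    have hlen' : hE.invariantForm.form (P.root i) (P.root i) =
        hE.invariantForm.form (P.root j) (P.root j) := by
      change ⟪P.root i, P.root i⟫_ℝ = ⟪P.root j, P.root j⟫_ℝ
      rw [real_inner_self_eq_norm_sq, real_inner_self_eq_norm_sq, hlen i hi j hj]
    have hmem := P.pairingIn_pairingIn_mem_set_of_length_eq_of_ne hlen'
      (fun h => hcon.1 (by rw [h])) hcon.2
    have e1 := P.algebraMap_pairingIn ℤ i j
    have e2 := P.algebraMap_pairingIn ℤ j i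
    simp only [Set.mem_insert_iff, Set.mem_singleton_iff, Prod.mk.injEq] at hmem
    rcases hmem with ⟨a, b⟩ | ⟨a, b⟩ | ⟨a, b⟩ <;> rw [a] at e1 <;> rw [b] at e2 <;>
      simp only [algebraMap_int_eq, eq_intCast, Int.cast_zero, Int.cast_one, Int.cast_neg]
        at e1 e2
    · exact h0 ((hE.inner_eq_zero_iff i j).2 e1.symm)
    · refine hex ⟨P.reflectionPerm i i, hJ i i hi, j, hj, ?_, ?_⟩
      · rw [P.pairing_reflectionPerm_self_left, ← e1]
      · rw [P.pairing_reflectionPerm_self_right, ← e2]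
    · exact hex ⟨i, hi, j, hj, e1.symm, e2.symm⟩
  -- The frame is a maximal pairwise orthogonal subset of `J`. A root of `J` that is not `±` an
  -- element of `M` would be orthogonal to all of `M` and could be added.
  obtain ⟨M, ⟨hMJ, hMo⟩, hmax⟩ := (Set.toFinite {M : Set ι | M ⊆ J ∧
      M.Pairwise fun i j => ⟪P.root i, P.root j⟫_ℝ = 0}).exists_maximal
    ⟨∅, Set.empty_subset _, Set.pairwise_empty _⟩
  have hrep : ∀ i ∈ J, ∃ a ∈ M, P.root i = P.root a ∨ P.root i = -P.root a := by
    intro i hi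
    by_contra! hcon
    have hin : insert i M ∈ {M : Set ι | M ⊆ J ∧
        M.Pairwise fun i j => ⟪P.root i, P.root j⟫_ℝ = 0} := by
      refine ⟨Set.insert_subset hi hMJ, ?_⟩
      refine hMo.insert fun b hb _ => ?_
      rw [real_inner_comm, and_self, real_inner_comm]
      by_contra h
      rcases horth i hi b (hMJ hb) h with h1 | h1
      · exact (hcon b hb).1 h1
      · exact (hcon b hb).2 h1
    exact (hcon i (hmax hin (Set.subset_insert i M) (Set.mem_insert i M))).1 rfl
  have hMfin : Finite M := Set.toFinite M
  obtain ⟨n, ⟨ε⟩⟩ := Finite.exists_equiv_fin M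
  have hrep' : ∀ i ∈ J, ∃ a, P.root i = P.root (ε.symm a) ∨ P.root i = -P.root (ε.symm a) := by
    intro i hi
    obtain ⟨a, ha, h⟩ := hrep i hi
    exact ⟨ε ⟨a, ha⟩, by simpa using h⟩
  refine ⟨n, fun a => (ε.symm a : ι), ?_, fun a => hMJ (ε.symm a).2, ?_, hrep', ?_⟩
  · obtain ⟨i, hi⟩ := hne
    obtain ⟨a, -⟩ := hrep' i hi
    exact a.pos
  · intro a b hab
    refine hMo (ε.symm a).2 (ε.symm b).2 fun h => hab ?_
    exact ε.symm.injective (Subtype.ext h)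
  · have hspan : Submodule.span ℝ (P.root '' J) = ⊤ := by
      refine hE.span_eq_top_of_refl_mem (Set.image_subset_range _ _) (hne.image _) ?_
      rintro _ ⟨a, rfl⟩ _ ⟨k, hk, rfl⟩
      exact ⟨_, hJ a k hk, (hE.refl_root_root a k).symm⟩
    rw [eq_top_iff, ← hspan, Submodule.span_le]
    rintro _ ⟨k, hk, rfl⟩
    obtain ⟨a, h | h⟩ := hrep' k hk
    · rw [h]
      exact Submodule.subset_span ⟨a, rfl⟩
    · rw [h]
      exact Submodule.neg_mem _ (Submodule.subset_span ⟨a, rfl⟩)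

end Crystallographic

end FiniteRootSystems

/-! ### Characterising types `A₁`, `B` and `C` by the absence of roots at 120 degrees -/

section Types

variable {ι V N : Type*} [NormedAddCommGroup V] [InnerProductSpace ℝ V]
  [AddCommGroup N] [Module ℝ N] {P : RootPairing ι ℝ V N}

theorem isOrthogonal_frame_of {n : ℕ} {f : Fin n → ι} {d : ℝ}
    (horth : ∀ a b, a ≠ b → ⟪P.root (f a), P.root (f b)⟫_ℝ = 0)
    (hd : ∀ a, ⟪P.root (f a), P.root (f a)⟫_ℝ = d) (i j : Fin n) :
    ⟪P.root (f i), P.root (f j)⟫_ℝ = if i = j then d else 0 := by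
  split_ifs with h
  · rw [h, hd]
  · exact horth i j h

omit [InnerProductSpace ℝ V] in
theorem signedSums_eq_empty {u : Fin 1 → V} : signedSums u = ∅ := by
  ext x
  simp only [signedSums, Set.mem_ofPred_eq, Set.mem_empty_iff_false, iff_false]
  rintro ⟨i, j, hij, -⟩
  exact hij (Subsingleton.elim i j)

/-- Rotating the frame by 45 degrees turns type `C₂` into type `B₂`. -/
theorem isTypeB_of_frame_two {u : Fin 2 → V} {c : ℝ} (hc : 0 < c)
    (hu : ∀ i j, ⟪u i, u j⟫_ℝ = if i = j then c else 0)
    (h : Set.range P.root = {v | ∃ a, v = (2 : ℝ) • u a ∨ v = -((2 : ℝ) • u a)} ∪ signedSums u) :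
    IsTypeB P := by
  have h00 : ⟪u 0, u 0⟫_ℝ = c := by rw [hu, if_pos rfl]
  have h11 : ⟪u 1, u 1⟫_ℝ = c := by rw [hu, if_pos rfl]
  have h01 : ⟪u 0, u 1⟫_ℝ = 0 := by simp [hu]
  have h10 : ⟪u 1, u 0⟫_ℝ = 0 := by simp [hu]
  refine ⟨2, ![u 0 + u 1, u 0 - u 1], le_rfl, ⟨2 * c, by linarith, ?_⟩, ?_⟩
  · intro i j
    fin_cases i <;> fin_cases j <;>
      simp only [Fin.zero_eta, Fin.mk_one, Matrix.cons_val_zero, Matrix.cons_val_one,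
        inner_add_left, inner_add_right, inner_sub_left, inner_sub_right, h00, h01, h10, h11] <;>
      norm_num <;> ring
  · rw [h]
    ext v
    simp only [signedSums, Set.mem_union, Set.mem_ofPred_eq, Fin.exists_fin_two,
      Matrix.cons_val_zero, Matrix.cons_val_one, ne_eq, not_true_eq_false, false_and, zero_ne_one,
      one_ne_zero, not_false_eq_true, true_and, false_or, or_false, two_smul]
    have e1 : u 0 + u 1 + (u 0 - u 1) = u 0 + u 0 := by abel
    have e2 : u 0 + u 1 - (u 0 - u 1) = u 1 + u 1 := by abel
    have e3 : -(u 0 + u 1) - (u 0 - u 1) = -(u 0 + u 0) := by abel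
    have e4 : u 0 - u 1 + (u 0 + u 1) = u 0 + u 0 := by abel
    have e5 : u 0 - u 1 - (u 0 + u 1) = -(u 1 + u 1) := by abel
    have e6 : -(u 0 - u 1) - (u 0 + u 1) = -(u 0 + u 0) := by abel
    have e7 : -(u 0 - u 1) = u 1 - u 0 := by abel
    have e8 : -(u 0 + u 1) = -u 0 - u 1 := by abel
    have e9 : -u 1 - u 0 = -u 0 - u 1 := by abel
    have e10 : u 1 + u 0 = u 0 + u 1 := by abel
    rw [e1, e2, e3, e4, e5, e6, e7, e8, e9, e10]
    tauto

section TypeC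

variable [Finite ι]

/-- In type `C`, the long roots are the vectors `±2ε_i`, and the lacing number is `2`. -/
theorem IsTypeC.lacing_eq_and_long (hC : IsTypeC P) (hne : (short P).Nonempty)
    (hnl : (long P).Nonempty) : lacing P = 2 ∧
    ∀ i ∈ long P, ∀ j ∈ long P, ⟪P.root i, P.root j⟫_ℝ = ⟪P.root j, P.root j⟫_ℝ ∨
      ⟪P.root i, P.root j⟫_ℝ = -⟪P.root j, P.root j⟫_ℝ ∨ ⟪P.root i, P.root j⟫_ℝ = 0 := by
  obtain ⟨n, e, hn, ⟨c, hc, he⟩, hr⟩ := hC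
  have hmem : ∀ i, (∃ a, P.root i = (2 : ℝ) • e a ∨ P.root i = -((2 : ℝ) • e a)) ∨
      P.root i ∈ signedSums e := fun i => by
    have : P.root i ∈ Set.range P.root := ⟨i, rfl⟩
    rw [hr] at this
    exact this
  have hlenl : ∀ i, (∃ a, P.root i = (2 : ℝ) • e a ∨ P.root i = -((2 : ℝ) • e a)) →
      ⟪P.root i, P.root i⟫_ℝ = 4 * c := by
    rintro i ⟨a, h | h⟩ <;> rw [h] <;>
      simp only [inner_neg_neg, real_inner_smul_left, real_inner_smul_right, he, if_pos] <;> ring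
  have hlens : ∀ i, P.root i ∈ signedSums e → ⟪P.root i, P.root i⟫_ℝ = 2 * c := by
    rintro i ⟨a, b, hab, h | h | h⟩ <;> rw [h] <;>
      simp only [inner_add_left, inner_add_right, inner_sub_left, inner_sub_right, inner_neg_left,
        inner_neg_right, he, if_pos, if_neg hab, if_neg hab.symm] <;> ring
  let a₀ : Fin n := ⟨0, by omega⟩
  let b₀ : Fin n := ⟨1, by omega⟩
  have hab₀ : a₀ ≠ b₀ := by simp [a₀, b₀]
  obtain ⟨x, hx⟩ : (2 : ℝ) • e a₀ ∈ Set.range P.root := by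
    rw [hr]
    exact Or.inl ⟨a₀, Or.inl rfl⟩
  obtain ⟨y, hy⟩ : e a₀ + e b₀ ∈ Set.range P.root := by
    rw [hr]
    exact Or.inr ⟨a₀, b₀, hab₀, Or.inl rfl⟩
  have hxl := hlenl x ⟨a₀, Or.inl hx⟩
  have hyl := hlens y ⟨a₀, b₀, hab₀, Or.inl hy⟩
  have hlong : ∀ i ∈ long P, ∃ a, P.root i = (2 : ℝ) • e a ∨ P.root i = -((2 : ℝ) • e a) := by
    intro i hi
    refine (hmem i).resolve_right fun h => ?_
    have h1 := (inner_root_le_iff P x i).2 (hi x)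
    rw [hxl, hlens i h] at h1
    linarith
  refine ⟨?_, ?_⟩
  · obtain ⟨i, hi⟩ := hne
    obtain ⟨j, hj⟩ := hnl
    have hi' : ⟪P.root i, P.root i⟫_ℝ = 2 * c := by
      rcases hmem i with h | h
      · have h1 := (inner_root_le_iff P i y).2 (hi y)
        rw [hyl, hlenl i h] at h1
        linarith
      · exact hlens i h
    have h1 := inner_long_eq_lacing_mul hi hj
    rw [hi', hlenl j (hlong j hj)] at h1
    have h2 : (lacing P - 2) * (2 * c) = 0 := by linarith
    have := (mul_eq_zero.1 h2).resolve_right (by linarith)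
    linarith
  · intro i hi j hj
    obtain ⟨a, ha⟩ := hlong i hi
    obtain ⟨b, hb⟩ := hlong j hj
    by_cases hab : a = b
    · subst hab
      rcases ha with ha | ha <;> rcases hb with hb | hb <;> rw [ha, hb] <;> simp
    · right; right
      rcases ha with ha | ha <;> rcases hb with hb | hb <;> rw [ha, hb] <;>
        simp [real_inner_smul_left, real_inner_smul_right, he, hab]

end TypeC

section Crystallographic

variable [Finite ι] [P.IsRootSystem] [P.IsCrystallographic] [P.IsReduced] [P.IsIrreducible]

/-- A short and a long root of different lengths are perpendicular or have pairing `±1`. -/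
theorem IsEuclidean.pairing_short_long (hE : IsEuclidean P) {i j : ι} (hi : i ∈ short P)
    (hj : j ∈ long P) (hm : lacing P ≠ 1) :
    ∃ z : ℤ, (z = 0 ∨ z = 1 ∨ z = -1) ∧ P.pairing i j = z := by
  refine ⟨P.pairingIn ℤ i j, ?_, by simpa using (P.algebraMap_pairingIn ℤ i j).symm⟩
  have h1 := hE.pairing_eq_lacing_mul hi hj
  obtain ⟨m, hm1, hm2⟩ := hE.exists_int_eq_lacing
  have e1 := P.algebraMap_pairingIn ℤ i j
  have e2 := P.algebraMap_pairingIn ℤ j i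
  rw [← e1, ← e2, ← hm1] at h1
  have h2 : P.pairingIn ℤ j i = m * P.pairingIn ℤ i j := by
    simp only [algebraMap_int_eq, eq_intCast] at h1
    exact_mod_cast h1
  -- Pairings are at most `3` in absolute value, and one is `m ≥ 2` times the other, so the smaller
  -- is `0` or `±1`.
  have hmem := P.pairingIn_pairingIn_mem_set_of_isCrystal_of_isRed i j
  have hm3 : m ≠ 1 := fun h => hm (by rw [← hm1, h]; norm_num)
  simp only [Set.mem_insert_iff, Set.mem_singleton_iff, Prod.mk.injEq] at hmem
  rcases hm2 with rfl | rfl | rfl <;> omega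

/-- The arithmetic that rules out `m = 3`: here `N` is the number of nonzero coordinates of a root
in a frame of roots of the other length. -/
theorem eq_two_of_mul_eq_four {m N : ℤ} (hm : m = 1 ∨ m = 2 ∨ m = 3) (hm1 : m ≠ 1)
    (h : m * N = 4) : m = 2 ∧ N = 2 := by
  rcases hm with rfl | rfl | rfl <;> omega

/-- Outside of the types `A₁` and `B`, two short roots form an angle of `120` degrees. -/
theorem IsEuclidean.exists_short_short (hE : IsEuclidean P) (hA : ¬ IsTypeA1 P)
    (hB : ¬ IsTypeB P) :
    ∃ i ∈ short P, ∃ j ∈ short P, P.pairing i j = -1 ∧ P.pairing j i = -1 := by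
  refine (hE.exists_pairing_eq_neg_one_or_frame (short_nonempty P)
    (fun a k hk => (hE.reflectionPerm_mem_short a).2 hk)
    (fun i hi j hj => norm_eq_of_mem_short hi hj)).resolve_right ?_
  rintro ⟨n, f, hn, hfJ, horth, hrep, hspan⟩
  obtain ⟨i₀, hi₀⟩ := short_nonempty P
  set d := ⟪P.root i₀, P.root i₀⟫_ℝ with hd
  have hd0 : 0 < d := inner_root_pos P i₀
  have hu := isOrthogonal_frame_of horth (d := d) fun a => by
    rw [hd, real_inner_self_eq_norm_sq, real_inner_self_eq_norm_sq,
      norm_eq_of_mem_short (hfJ a) hi₀]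
  obtain ⟨m, hm1, hm2⟩ := hE.exists_int_eq_lacing
  -- In the short frame a long root has coordinates `z_a m / 2` with `z_a ∈ {0, ±1}` and squared
  -- length `m d`. Parseval then gives `m N = 4` for the number `N` of nonzero `z_a`, so `m = N = 2`
  -- and the root is a signed sum.
  have hcover : ∀ x ∈ Set.range P.root, (∃ a, x = (1 : ℝ) • P.root (f a) ∨
      x = -((1 : ℝ) • P.root (f a))) ∨ x ∈ signedSums fun a => P.root (f a) := by
    rintro _ ⟨k, rfl⟩
    by_cases hk : k ∈ short P
    · obtain ⟨a, ha⟩ := hrep k hk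
      exact Or.inl ⟨a, by simpa using ha⟩
    right
    have hkl := (hE.mem_short_or_mem_long k).resolve_left hk
    have hm3 : lacing P ≠ 1 := by
      intro h
      refine hk fun j => ?_
      rw [← inner_root_le_iff, inner_long_eq_lacing_mul hi₀ hkl, h, one_mul]
      exact (inner_root_le_iff P _ _).2 (hi₀ j)
    choose z hz hzp using fun a => hE.pairing_short_long (hfJ a) hkl hm3
    have hin : ∀ a, ⟪P.root k, P.root (f a)⟫_ℝ = z a * (m / 2 * d) := by
      intro a
      have h1 := hE.two_inner k (f a)
      rw [hE.pairing_eq_lacing_mul (hfJ a) hkl, hzp, hu, if_pos rfl, ← hm1] at h1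
      linarith
    have hpars := frame_parseval hd0 hu hspan (P.root k)
    rw [inner_long_eq_lacing_mul hi₀ hkl, ← hm1, ← hd] at hpars
    simp only [hin, mul_pow] at hpars
    rw [← Finset.sum_mul] at hpars
    have hm0 : (m : ℝ) ≠ 0 := by
      rcases hm2 with rfl | rfl | rfl <;> norm_num
    have hN : m * ∑ a, z a ^ 2 = 4 := by
      have : ((m * ∑ a, z a ^ 2 : ℤ) : ℝ) = (4 : ℤ) := by
        push_cast
        have h2 : ((m : ℝ) * d ^ 2 / 4) * (m * ∑ a, (z a : ℝ) ^ 2) = ((m : ℝ) * d ^ 2 / 4) * 4 := by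
          linarith
        exact mul_left_cancel₀ (by positivity) h2
      exact_mod_cast this
    obtain ⟨hm4, hN2⟩ := eq_two_of_mul_eq_four hm2
      (fun h => hm3 (by rw [← hm1, h]; norm_num)) hN
    refine mem_signedSums hd0 hu hspan hz (fun a => ?_) hN2
    rw [hin, hm4]
    norm_num
  have hrange := hE.range_root_eq_of_frame hd0 hu one_ne_zero
    (fun a => ⟨f a, by rw [one_smul]⟩) hcover
  simp only [one_smul] at hrange
  by_cases hn1 : n = 1
  · subst hn1
    refine hA ⟨P.root (f 0), ?_⟩
    rw [hrange, signedSums_eq_empty, Set.union_empty]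
    ext v
    simp [Fin.exists_fin_one]
  · exact hB ⟨n, fun a => P.root (f a), by omega, ⟨d, hd0, hu⟩, hrange⟩

/-- Outside of the types `A₁`, `B` and `C`, two long roots form an angle of `120` degrees. -/
theorem IsEuclidean.exists_long_long (hE : IsEuclidean P) (hA : ¬ IsTypeA1 P)
    (hB : ¬ IsTypeB P) (hC : ¬ IsTypeC P) :
    ∃ i ∈ long P, ∃ j ∈ long P, P.pairing i j = -1 ∧ P.pairing j i = -1 := by
  refine (hE.exists_pairing_eq_neg_one_or_frame (long_nonempty P)
    (fun a k hk => (hE.reflectionPerm_mem_long a).2 hk)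
    (fun i hi j hj => norm_eq_of_mem_long hi hj)).resolve_right ?_
  rintro ⟨n, f, hn, hfJ, horth, hrep, hspan⟩
  obtain ⟨i₀, hi₀⟩ := long_nonempty P
  set d := ⟪P.root i₀, P.root i₀⟫_ℝ / 4 with hd
  have hd0 : 0 < d := div_pos (inner_root_pos P i₀) (by norm_num)
  have hd4 : ⟪P.root i₀, P.root i₀⟫_ℝ = 4 * d := by linarith
  have hf := isOrthogonal_frame_of horth (d := 4 * d) fun a => by
    rw [← hd4, real_inner_self_eq_norm_sq, real_inner_self_eq_norm_sq,
      norm_eq_of_mem_long (hfJ a) hi₀]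
  -- Halving the long frame matches the normalisation of type `C`: the long roots become `±2u_a`,
  -- and the short roots have coordinates `0` or `±1`.
  let u : Fin n → V := fun a => (2⁻¹ : ℝ) • P.root (f a)
  have h2u : ∀ a, (2 : ℝ) • u a = P.root (f a) := fun a => by simp [u, smul_smul]
  have hu : ∀ i j, ⟪u i, u j⟫_ℝ = if i = j then d else 0 := by
    intro i j
    simp only [u, real_inner_smul_left, real_inner_smul_right, hf]
    split_ifs <;> ring
  have hspanu : Submodule.span ℝ (Set.range u) = ⊤ := by
    rw [eq_top_iff, ← hspan, Submodule.span_le]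
    rintro _ ⟨a, rfl⟩
    simp only [← h2u]
    exact Submodule.smul_mem _ _ (Submodule.subset_span ⟨a, rfl⟩)
  obtain ⟨m, hm1, hm2⟩ := hE.exists_int_eq_lacing
  have hcover : ∀ x ∈ Set.range P.root, (∃ a, x = (2 : ℝ) • u a ∨
      x = -((2 : ℝ) • u a)) ∨ x ∈ signedSums u := by
    rintro _ ⟨k, rfl⟩
    by_cases hk : k ∈ long P
    · obtain ⟨a, ha⟩ := hrep k hk
      exact Or.inl ⟨a, by simpa only [h2u] using ha⟩
    right
    have hks := (hE.mem_short_or_mem_long k).resolve_right hk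
    have hm3 : lacing P ≠ 1 := by
      intro h
      refine hk fun j => ?_
      have := inner_long_eq_lacing_mul hks hi₀
      rw [h, one_mul] at this
      rw [← inner_root_le_iff, ← this]
      exact (inner_root_le_iff P _ _).2 (hi₀ j)
    choose z hz hzp using fun a => hE.pairing_short_long hks (hfJ a) hm3
    have hin : ∀ a, ⟪P.root k, u a⟫_ℝ = z a * d := by
      intro a
      have h1 := hE.two_inner k (f a)
      rw [hzp, hf, if_pos rfl] at h1
      simp only [u, real_inner_smul_right]
      linarith
    have hpars := frame_parseval hd0 hu hspanu (P.root k)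
    have hlk := inner_long_eq_lacing_mul hks hi₀
    rw [hd4, ← hm1] at hlk
    simp only [hin, mul_pow] at hpars
    rw [← Finset.sum_mul] at hpars
    have hN : m * ∑ a, z a ^ 2 = 4 := by
      have : ((m * ∑ a, z a ^ 2 : ℤ) : ℝ) = (4 : ℤ) := by
        push_cast
        have h2 : d ^ 2 * (m * ∑ a, (z a : ℝ) ^ 2) = d ^ 2 * 4 := by
          calc d ^ 2 * (m * ∑ a, (z a : ℝ) ^ 2) = m * ((∑ a, (z a : ℝ) ^ 2) * d ^ 2) := by ring
            _ = (m * ⟪P.root k, P.root k⟫_ℝ) * d := by rw [← hpars]; ring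
            _ = d ^ 2 * 4 := by rw [← hlk]; ring
        exact mul_left_cancel₀ (by positivity) h2
      exact_mod_cast this
    obtain ⟨-, hN2⟩ := eq_two_of_mul_eq_four hm2
      (fun h => hm3 (by rw [← hm1, h]; norm_num)) hN
    exact mem_signedSums hd0 hu hspanu hz hin hN2
  have hrange := hE.range_root_eq_of_frame hd0 hu two_ne_zero
    (fun a => ⟨f a, (h2u a).symm⟩) hcover
  by_cases hn1 : n = 1
  · subst hn1
    refine hA ⟨P.root (f 0), ?_⟩
    rw [hrange, signedSums_eq_empty, Set.union_empty]
    ext v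
    simp [Fin.exists_fin_one, h2u]
  by_cases hn2 : n = 2
  · subst hn2
    exact hB (isTypeB_of_frame_two hd0 hu hrange)
  · exact hC ⟨n, u, by omega, ⟨d, hd0, hu⟩, hrange⟩

/-- A short and a long root with pairing `-1`. -/
theorem IsEuclidean.exists_short_long (hE : IsEuclidean P) (hA : ¬ IsTypeA1 P)
    (hB : ¬ IsTypeB P) : ∃ i ∈ short P, ∃ j ∈ long P, P.pairing i j = -1 := by
  by_cases hm : lacing P = 1
  · obtain ⟨i, hi, j, hj, h, -⟩ := hE.exists_short_short hA hB
    obtain ⟨k, hk⟩ := long_nonempty P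
    refine ⟨i, hi, j, fun l => ?_, h⟩
    have := inner_long_eq_lacing_mul hj hk
    rw [hm, one_mul] at this
    rw [← inner_root_le_iff, ← this]
    exact (inner_root_le_iff P _ _).2 (hk l)
  · obtain ⟨i, hi⟩ := short_nonempty P
    obtain ⟨j, hj⟩ := long_nonempty P
    -- Replace the short root by one of the same length that is not perpendicular to `j`; its
    -- pairing is `±1`, and negation corrects the sign.
    obtain ⟨k, hk1, hk2⟩ := P.exists_form_eq_form_and_form_ne_zero hE.invariantForm j i
    replace hk1 : ⟪P.root k, P.root k⟫_ℝ = ⟪P.root i, P.root i⟫_ℝ := hk1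
    replace hk2 : ⟪P.root j, P.root k⟫_ℝ ≠ 0 := hk2
    have hk : k ∈ short P := fun l => by
      rw [← inner_root_le_iff, hk1]
      exact (inner_root_le_iff P _ _).2 (hi l)
    rw [real_inner_comm, ne_eq, hE.inner_eq_zero_iff] at hk2
    obtain ⟨z, hz, hz'⟩ := hE.pairing_short_long hk hj hm
    rcases hz with rfl | rfl | rfl
    · simp [hz'] at hk2
    · refine ⟨P.reflectionPerm k k, (hE.reflectionPerm_mem_short k).2 hk, j, hj, ?_⟩
      rw [P.pairing_reflectionPerm_self_left, hz']
      norm_num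
    · exact ⟨k, hk, j, hj, by rw [hz']; norm_num⟩

end Crystallographic

end Types

namespace ExtensionDatum

/-! ### Subsystems containing the graph of a `ℤ`-linear map, described by length pairs -/

section LengthPairs

variable {ι V N Y : Type*} [NormedAddCommGroup V] [InnerProductSpace ℝ V]
  [AddCommGroup N] [Module ℝ N] [AddCommGroup Y] [Module ℝ Y] {P : RootPairing ι ℝ V N}

/-- Consequently reflections preserve the graph of `p`, and shifting fibres by `p` is compatible
with reflections. -/
theorem val_reflectionPerm [P.IsCrystallographic] (p : P.rootSpan ℤ →ₗ[ℤ] Y) (i j : ι) :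
    val p (P.reflectionPerm i j) = val p j - P.pairing j i • val p i := by
  have h : P.rootSpanMem ℤ (P.reflectionPerm i j) =
      P.rootSpanMem ℤ j - P.pairingIn ℤ j i • P.rootSpanMem ℤ i := by
    apply Subtype.ext
    change P.root (P.reflectionPerm i j) = P.root j - P.pairingIn ℤ j i • P.root i
    rw [P.root_reflectionPerm, P.reflection_apply_root' ℤ]
  rw [val, h, map_sub, map_smul, ← P.algebraMap_pairingIn ℤ j i, algebraMap_int_eq, eq_intCast,
    Int.cast_smul_eq_zsmul]
  rfl

/-- The real roots of the affine reflection system attached to an extension datum. -/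
def realRoots (D : ExtensionDatum P Y) : Set (V × Y) := graded P Set.univ D.Λ

omit [AddCommGroup Y] [Module ℝ Y] in
theorem mem_graded_root {J : Set ι} {Z : ι → Set Y} {i : ι} {y : Y} :
    (P.root i, y) ∈ graded P J Z ↔ i ∈ J ∧ y ∈ Z i := by
  constructor
  · rintro ⟨j, hj, h1, h2⟩
    rw [P.root.injective h1]
    exact ⟨hj, h2⟩
  · rintro ⟨h1, h2⟩
    exact ⟨i, h1, rfl, h2⟩

theorem mem_realRoots {D : ExtensionDatum P Y} {i : ι} {y : Y} :
    (P.root i, y) ∈ D.realRoots ↔ y ∈ D.Λ i := by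
  simp [realRoots, mem_graded_root]

/-- The second component is the expression in the axiom `sub_mem`, so reflection stability of a set
of roots is a condition of that form on its fibres. -/
theorem refl_sumForm (hE : IsEuclidean P) (i j : ι) (y z : Y) :
    refl (sumForm V Y) (P.root i, z) (P.root j, y) =
      (P.root (P.reflectionPerm i j), y - P.pairing j i • z) := by
  rw [refl, coPairing_sumForm, hE.coPairing_root, P.root_coroot'_eq_pairing,
    P.root_reflectionPerm, P.reflection_apply_root]
  rfl

/-- The axiom only excepts roots that are twice another root, and a reduced system has none. -/
theorem zero_mem_Λ [P.IsReduced] (D : ExtensionDatum P Y) (i : ι) : 0 ∈ D.Λ i := by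
  refine D.zero_mem i fun j hj => ?_
  have h0 := P.ne_zero j
  rcases RootPairing.IsReduced.eq_or_eq_neg (P := P) i j (by
      rw [hj, LinearIndependent.pair_iff]
      intro h
      have h1 := (h 1 (-2) (by module)).1
      norm_num at h1) with h | h
  · rw [hj, two_smul, add_eq_left] at h
    exact h0 h
  · rw [hj] at h
    have h3 : (3 : ℝ) • P.root j = 0 := by
      rw [show (3 : ℝ) = 2 + 1 by norm_num, add_smul, h, one_smul, neg_add_cancel]
    exact h0 ((smul_eq_zero.1 h3).resolve_left (by norm_num))

/-- A root subsystem with full gradient contains the graph of a `ℤ`-linear map. -/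
theorem exists_val_mem [Finite ι] [P.IsRootSystem] [P.IsCrystallographic] [P.IsReduced]
    (hE : IsEuclidean P) {Ψ : Set (V × Y)}
    (hΨ : ∀ α ∈ Ψ, ∀ β ∈ Ψ, refl (sumForm V Y) α β ∈ Ψ) (hfull : ∀ i, ∃ y, (P.root i, y) ∈ Ψ) :
    ∃ p : P.rootSpan ℤ →ₗ[ℤ] Y, ∀ i, (P.root i, val p i) ∈ Ψ := by
  obtain ⟨b⟩ := P.nonempty_base
  choose y hy using hfull
  -- The values on the simple roots are arbitrary points of `Ψ`. Every root is reached from simple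
  -- ones by reflections in simple roots, which keep the graph inside `Ψ`.
  refine ⟨b.toWeightBasisInt.constr ℤ fun i => y i, fun i => ?_⟩
  have hstep : ∀ i j, (P.root i, val (b.toWeightBasisInt.constr ℤ fun i => y i) i) ∈ Ψ →
      (P.root j, val (b.toWeightBasisInt.constr ℤ fun i => y i) j) ∈ Ψ →
      (P.root (P.reflectionPerm j i),
        val (b.toWeightBasisInt.constr ℤ fun i => y i) (P.reflectionPerm j i)) ∈ Ψ := by
    intro i j hi hj
    have := hΨ _ hj _ hi
    rwa [refl_sumForm hE, ← val_reflectionPerm] at this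
  have hbase : ∀ i ∈ b.support, (P.root i, val (b.toWeightBasisInt.constr ℤ fun i => y i) i) ∈ Ψ := by
    intro i hi
    have h1 : P.rootSpanMem ℤ i = b.toWeightBasisInt ⟨i, hi⟩ :=
      Subtype.ext (b.coe_toWeightBasisInt_apply ⟨i, hi⟩).symm
    rw [val, h1, Module.Basis.constr_basis]
    exact hy i
  exact b.induction_reflect i (fun i hi => hstep i i hi hi) hbase
    fun i j hi hj => hstep i j hi (hbase j hj)

/-- The conditions on the two fibres (over the short and over the long roots) of a root subsystem
with full gradient containing the zero section. -/
def IsLengthPair (P : RootPairing ι ℝ V N) (H : AddSubgroup Y) (S : Set Y) : Prop :=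
  0 ∈ S ∧ S ⊆ H ∧ (∀ x ∈ S, ∀ h ∈ H, x + lacing P • h ∈ S) ∧
    (¬ IsTypeC P → ∃ K : AddSubgroup Y, S = K)

/-- Translating `0 ∈ S` by `mH` fills `H`. This keeps the two halves of `pairSet` consistent when a
root is both short and long. -/
theorem IsLengthPair.eq_of_lacing {H : AddSubgroup Y} {S : Set Y} (h : IsLengthPair P H S)
    (hm : lacing P = 1) : S = H := by
  refine Set.Subset.antisymm h.2.1 fun x hx => ?_
  have := h.2.2.1 0 h.1 x hx
  rwa [hm, one_smul, zero_add] at this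

section Datum

variable [Finite ι] [P.IsRootSystem] [P.IsCrystallographic] [P.IsReduced] [P.IsIrreducible]
  (hE : IsEuclidean P)
include hE

theorem Λ_short (D : ExtensionDatum P Y) {i : ι} (hi : i ∈ short P) : D.Λ i = D.Λs := by
  ext y
  constructor
  · exact fun h => ⟨i, hi, h⟩
  · rintro ⟨j, hj, h⟩
    rwa [D.Λ_eq_of_norm_eq hE (norm_eq_of_mem_short hi hj)]

theorem Λ_long (D : ExtensionDatum P Y) {i : ι} (hi : i ∈ long P) : D.Λ i = D.Λl := by
  ext y
  constructor
  · exact fun h => ⟨i, hi, h⟩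
  · rintro ⟨j, hj, h⟩
    rwa [D.Λ_eq_of_norm_eq hE (norm_eq_of_mem_long hi hj)]

theorem _root_.AffRefl.lacing_smul_eq_zsmul : ∃ m : ℤ, (m : ℝ) = lacing P ∧
    ∀ y : Y, lacing P • y = m • y := by
  obtain ⟨m, hm, -⟩ := hE.exists_int_eq_lacing
  exact ⟨m, hm, fun y => by rw [← hm, Int.cast_smul_eq_zsmul]⟩

theorem _root_.AffRefl.lacing_smul_mem (H : AddSubgroup Y) {y : Y} (hy : y ∈ H) :
    lacing P • y ∈ H := by
  obtain ⟨m, -, hm⟩ := lacing_smul_eq_zsmul (Y := Y) hE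
  rw [hm]
  exact H.zsmul_mem hy m

omit hE [Finite ι] [P.IsRootSystem] [P.IsReduced] [P.IsIrreducible] in
theorem _root_.AffRefl.pairing_smul_mem (H : AddSubgroup Y) {y : Y} (hy : y ∈ H) (i j : ι) :
    P.pairing j i • y ∈ H := by
  rw [← P.algebraMap_pairingIn ℤ j i, algebraMap_int_eq, eq_intCast, Int.cast_smul_eq_zsmul]
  exact H.zsmul_mem hy _

omit hE [Finite ι] [P.IsRootSystem] [P.IsCrystallographic] [P.IsIrreducible] in
theorem neg_mem_Λ (D : ExtensionDatum P Y) {i : ι} {y : Y} (hy : y ∈ D.Λ i) : -y ∈ D.Λ i := by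
  have := D.sub_mem i i y hy y hy
  rw [D.Λ_reflectionPerm, P.pairing_same, two_smul] at this
  simpa using this

/-- Each property comes from `sub_mem` for one pair of roots with pairing `-1`. Two short roots at
120 degrees give sums in `Λ_s`. Reflecting a short root in a long one gives `Λ_ℓ ⊆ Λ_s`, and
reflecting the long one in the short one gives `Λ_ℓ + mΛ_s ⊆ Λ_ℓ`. Outside type `C`, two long roots
at 120 degrees give sums in `Λ_ℓ`. -/
theorem exists_isLengthPair (hA : ¬ IsTypeA1 P) (hB : ¬ IsTypeB P) (D : ExtensionDatum P Y) :
    ∃ H : AddSubgroup Y, (H : Set Y) = D.Λs ∧ IsLengthPair P H D.Λl := by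
  obtain ⟨i, hi, j, hj, hij, -⟩ := hE.exists_short_short hA hB
  let H : AddSubgroup Y :=
    { carrier := D.Λs
      zero_mem' := ⟨i, hi, D.zero_mem_Λ i⟩
      add_mem' := by
        intro x y hx hy
        rw [← D.Λ_short hE hi] at hx
        rw [← D.Λ_short hE hj] at hy
        have := D.sub_mem j i x hx y hy
        rw [D.Λ_reflectionPerm, hij, neg_smul, one_smul, sub_neg_eq_add] at this
        exact ⟨i, hi, this⟩
      neg_mem' := by
        rintro x ⟨k, hk, hx⟩
        exact ⟨k, hk, D.neg_mem_Λ hx⟩ }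
  obtain ⟨k, hk, l, hl, hkl⟩ := hE.exists_short_long hA hB
  have hlk := hE.pairing_eq_lacing_mul hk hl
  rw [hkl, mul_neg_one] at hlk
  refine ⟨H, rfl, ⟨l, hl, D.zero_mem_Λ l⟩, ?_, ?_, ?_⟩
  · intro x hx
    rw [← D.Λ_long hE hl] at hx
    have := D.sub_mem l k 0 (D.zero_mem_Λ k) x hx
    rw [D.Λ_reflectionPerm, hkl, neg_smul, one_smul, sub_neg_eq_add, zero_add] at this
    exact ⟨k, hk, this⟩
  · intro x hx h hh
    replace hh : h ∈ D.Λs := hh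
    rw [← D.Λ_long hE hl] at hx
    rw [← D.Λ_short hE hk] at hh
    have := D.sub_mem k l x hx h hh
    rw [D.Λ_reflectionPerm, hlk, neg_smul, sub_neg_eq_add] at this
    exact ⟨l, hl, this⟩
  · intro hC
    obtain ⟨a, ha, b, hb, hab, -⟩ := hE.exists_long_long hA hB hC
    exact ⟨{ carrier := D.Λl
             zero_mem' := ⟨a, ha, D.zero_mem_Λ a⟩
             add_mem' := by
                intro x y hx hy
                rw [← D.Λ_long hE ha] at hx
                rw [← D.Λ_long hE hb] at hy
                have := D.sub_mem b a x hx y hy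
                rw [D.Λ_reflectionPerm, hab, neg_smul, one_smul, sub_neg_eq_add] at this
                exact ⟨a, ha, this⟩
             neg_mem' := by
                rintro x ⟨k, hk, hx⟩
                exact ⟨k, hk, D.neg_mem_Λ hx⟩ }, rfl⟩

/-- Conversely, a length pair defines a family of sets indexed by the roots that is compatible with
the reflections. -/
theorem IsLengthPair.sub_mem {H : AddSubgroup Y} {S : Set Y} (h : IsLengthPair P H S) (i j : ι)
    {y z : Y} (hy : (j ∈ short P → y ∈ H) ∧ (j ∈ long P → y ∈ S))
    (hz : (i ∈ short P → z ∈ H) ∧ (i ∈ long P → z ∈ S)) :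
    (j ∈ short P → y - P.pairing j i • z ∈ H) ∧ (j ∈ long P → y - P.pairing j i • z ∈ S) := by
  have hzH : z ∈ H := (hE.mem_short_or_mem_long i).elim hz.1 fun hi => h.2.1 (hz.2 hi)
  refine ⟨fun hj => H.sub_mem (hy.1 hj) (pairing_smul_mem (P := P) H hzH i j), fun hj => ?_⟩
  rcases hE.mem_short_or_mem_long i with hi | hi
  -- The pairing of a long root with a short coroot is `m` times an integer, so the shift lies in
  -- `mH`.
  · have := h.2.2.1 y (hy.2 hj) _ (H.neg_mem (pairing_smul_mem (P := P) H hzH j i))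
    rwa [smul_neg, smul_smul, ← hE.pairing_eq_lacing_mul hi hj, ← sub_eq_add_neg] at this
  -- In type `C` two long roots have pairing `0` or `±2`, and `m = 2`. The shift is again in `mH`,
  -- so `S` need not be a group.
  · by_cases hC : IsTypeC P
    · obtain ⟨hm, hC'⟩ := hC.lacing_eq_and_long (short_nonempty P) (long_nonempty P)
      have h2 := hE.two_inner j i
      have h0 := inner_root_pos P i
      rcases hC' j hj i hi with h1 | h1 | h1 <;> rw [h1] at h2
      · rw [← mul_right_cancel₀ h0.ne' h2]
        have := h.2.2.1 y (hy.2 hj) _ (H.neg_mem hzH)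
        rwa [hm, smul_neg, ← sub_eq_add_neg] at this
      · have h3 : P.pairing j i = -2 := mul_right_cancel₀ h0.ne' (by linarith)
        rw [h3]
        have := h.2.2.1 y (hy.2 hj) _ hzH
        rwa [hm, ← sub_neg_eq_add, ← neg_smul] at this
      · have h3 : P.pairing j i = 0 := mul_right_cancel₀ h0.ne' (by linarith)
        rw [h3, zero_smul, sub_zero]
        exact hy.2 hj
    · obtain ⟨K, rfl⟩ := h.2.2.2 hC
      exact K.sub_mem (hy.2 hj) (pairing_smul_mem (P := P) K (hz.2 hi) i j)

end Datum

/-- The set of roots `α ⊕ (p_α + H)`, `α` short, and `α ⊕ (p_α + S)`, `α` long. -/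
def pairSet (p : P.rootSpan ℤ →ₗ[ℤ] Y) (H : AddSubgroup Y) (S : Set Y) : Set (V × Y) :=
  graded P (short P) (fun i => val p i +ᵥ (H : Set Y)) ∪
    graded P (long P) (fun i => val p i +ᵥ S)

omit [Module ℝ Y] in
theorem _root_.AffRefl.mem_vadd_set_iff {x y : Y} {S : Set Y} : y ∈ x +ᵥ S ↔ y - x ∈ S := by
  rw [Set.mem_vadd_set_iff_neg_vadd_mem, vadd_eq_add, neg_add_eq_sub]

omit [Module ℝ Y] in
theorem exists_root_eq_of_mem_pairSet {p : P.rootSpan ℤ →ₗ[ℤ] Y} {H : AddSubgroup Y} {S : Set Y}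
    {x : V × Y} (hx : x ∈ pairSet p H S) : ∃ i y, x = (P.root i, y) := by
  rcases hx with ⟨i, -, h, -⟩ | ⟨i, -, h, -⟩ <;> exact ⟨i, x.2, Prod.ext h rfl⟩

section PairSet

variable [Finite ι]

omit [Finite ι] in
theorem mem_pairSet_short {p : P.rootSpan ℤ →ₗ[ℤ] Y} {H : AddSubgroup Y} {S : Set Y}
    (h : IsLengthPair P H S) {i : ι} (hi : i ∈ short P) {y : Y} :
    (P.root i, y) ∈ pairSet p H S ↔ y - val p i ∈ H := by
  simp only [pairSet, Set.mem_union, mem_graded_root, mem_vadd_set_iff, SetLike.mem_coe]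
  exact ⟨fun h' => h'.elim (fun h' => h'.2) fun h' => h.2.1 h'.2, fun h' => Or.inl ⟨hi, h'⟩⟩

theorem mem_pairSet_long {p : P.rootSpan ℤ →ₗ[ℤ] Y} {H : AddSubgroup Y} {S : Set Y}
    (h : IsLengthPair P H S) {i : ι} (hi : i ∈ long P) {y : Y} :
    (P.root i, y) ∈ pairSet p H S ↔ y - val p i ∈ S := by
  simp only [pairSet, Set.mem_union, mem_graded_root, mem_vadd_set_iff, SetLike.mem_coe]
  refine ⟨fun h' => h'.elim (fun h' => ?_) fun h' => h'.2, fun h' => Or.inr ⟨hi, h'⟩⟩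
  rw [h.eq_of_lacing (lacing_eq_one_of_mem h'.1 hi)]
  exact h'.2

variable [P.IsRootSystem] [P.IsCrystallographic] [P.IsReduced] [P.IsIrreducible]

theorem mem_pairSet (hE : IsEuclidean P) {p : P.rootSpan ℤ →ₗ[ℤ] Y} {H : AddSubgroup Y}
    {S : Set Y} (h : IsLengthPair P H S) {i : ι} {y : Y} :
    (P.root i, y) ∈ pairSet p H S ↔
      (i ∈ short P → y - val p i ∈ H) ∧ (i ∈ long P → y - val p i ∈ S) := by
  refine ⟨fun h' => ⟨fun hi => (mem_pairSet_short h hi).1 h', fun hi =>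
    (mem_pairSet_long h hi).1 h'⟩, fun h' => ?_⟩
  rcases hE.mem_short_or_mem_long i with hi | hi
  · exact (mem_pairSet_short h hi).2 (h'.1 hi)
  · exact (mem_pairSet_long h hi).2 (h'.2 hi)

omit [P.IsCrystallographic] [P.IsReduced] in
theorem pairSet_subset_iff {p : P.rootSpan ℤ →ₗ[ℤ] Y} {H H' : AddSubgroup Y} {S S' : Set Y}
    (h : IsLengthPair P H S) (h' : IsLengthPair P H' S') :
    pairSet p H S ⊆ pairSet p H' S' ↔ H ≤ H' ∧ S ⊆ S' := by
  constructor
  · intro hs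
    obtain ⟨i, hi⟩ := short_nonempty P
    obtain ⟨j, hj⟩ := long_nonempty P
    refine ⟨fun x hx => ?_, fun x hx => ?_⟩
    · have := hs ((mem_pairSet_short h hi (y := x + val p i)).2 (by simpa using hx))
      simpa using (mem_pairSet_short h' hi).1 this
    · have := hs ((mem_pairSet_long h hj (y := x + val p j)).2 (by simpa using hx))
      simpa using (mem_pairSet_long h' hj).1 this
  · rintro ⟨h1, h2⟩ x (⟨i, hi, hx, hy⟩ | ⟨i, hi, hx, hy⟩)
    · exact Or.inl ⟨i, hi, hx, Set.vadd_set_mono h1 hy⟩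
    · exact Or.inr ⟨i, hi, hx, Set.vadd_set_mono h2 hy⟩

omit [P.IsCrystallographic] [P.IsReduced] in
theorem pairSet_eq_iff {p : P.rootSpan ℤ →ₗ[ℤ] Y} {H H' : AddSubgroup Y} {S S' : Set Y}
    (h : IsLengthPair P H S) (h' : IsLengthPair P H' S') :
    pairSet p H S = pairSet p H' S' ↔ H = H' ∧ S = S' := by
  rw [Set.Subset.antisymm_iff, pairSet_subset_iff h h', pairSet_subset_iff h' h, le_antisymm_iff,
    Set.Subset.antisymm_iff]
  tauto

theorem refl_mem_pairSet (hE : IsEuclidean P) {p : P.rootSpan ℤ →ₗ[ℤ] Y} {H : AddSubgroup Y}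
    {S : Set Y} (h : IsLengthPair P H S) :
    ∀ α ∈ pairSet p H S, ∀ β ∈ pairSet p H S, refl (sumForm V Y) α β ∈ pairSet p H S := by
  intro α hα β hβ
  obtain ⟨i, z, rfl⟩ := exists_root_eq_of_mem_pairSet hα
  obtain ⟨j, y, rfl⟩ := exists_root_eq_of_mem_pairSet hβ
  rw [refl_sumForm hE, mem_pairSet hE h, hE.reflectionPerm_mem_short, hE.reflectionPerm_mem_long,
    val_reflectionPerm]
  rw [mem_pairSet hE h] at hα hβ
  have := h.sub_mem hE i j hβ hα
  rwa [show y - val p j - P.pairing j i • (z - val p i) =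
    y - P.pairing j i • z - (val p j - P.pairing j i • val p i) by module] at this

theorem val_mem_pairSet (hE : IsEuclidean P) {p : P.rootSpan ℤ →ₗ[ℤ] Y}
    {H : AddSubgroup Y} {S : Set Y} (h : IsLengthPair P H S) (i : ι) :
    (P.root i, val p i) ∈ pairSet p H S := by
  rw [mem_pairSet hE h, sub_self]
  exact ⟨fun _ => H.zero_mem, fun _ => h.1⟩

/-- Root subsystems containing the graph of `p` are given by length pairs. -/
theorem exists_eq_pairSet (hE : IsEuclidean P) (hA : ¬ IsTypeA1 P) (hB : ¬ IsTypeB P)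
    {p : P.rootSpan ℤ →ₗ[ℤ] Y} {Ψ : Set (V × Y)} (hroot : ∀ x ∈ Ψ, ∃ i, x.1 = P.root i)
    (hΨ : ∀ α ∈ Ψ, ∀ β ∈ Ψ, refl (sumForm V Y) α β ∈ Ψ) (hp : ∀ i, (P.root i, val p i) ∈ Ψ) :
    ∃ H S, IsLengthPair P H S ∧ Ψ = pairSet p H S := by
  -- The fibres of `Ψ`, shifted by `-p`, form an extension datum of their own. The choice of `Λ₀` as
  -- everything serves the spanning axiom alone.
  let E : ExtensionDatum P Y :=
    { Λ := fun i => {y | (P.root i, val p i + y) ∈ Ψ}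
      Λ₀ := Set.univ
      sub_mem := by
        intro i j y hy z hz
        have := hΨ _ hz _ hy
        rw [refl_sumForm hE] at this
        rw [Set.mem_ofPred_eq, val_reflectionPerm]
        convert! this using 2
        module
      zero_mem := fun i _ => by simpa using hp i
      zero_mem_zero := trivial
      nonempty := fun i => ⟨0, by simpa using hp i⟩
      span_eq_top := by simp }
  obtain ⟨H, hH, hpair⟩ := E.exists_isLengthPair hE hA hB
  refine ⟨H, E.Λl, hpair, ?_⟩
  have key : ∀ i y, (P.root i, y) ∈ Ψ ↔ (P.root i, y) ∈ pairSet p H E.Λl := by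
    intro i y
    have h1 : (P.root i, y) ∈ Ψ ↔ y - val p i ∈ E.Λ i := by
      change _ ↔ (P.root i, val p i + (y - val p i)) ∈ Ψ
      rw [add_sub_cancel]
    rw [h1]
    rcases hE.mem_short_or_mem_long i with hi | hi
    · rw [mem_pairSet_short hpair hi, E.Λ_short hE hi, ← hH, SetLike.mem_coe]
    · rw [mem_pairSet_long hpair hi, E.Λ_long hE hi]
  ext x
  constructor
  · intro hx
    obtain ⟨i, hi⟩ := hroot x hx
    have hx' : x = (P.root i, x.2) := Prod.ext hi rfl
    rw [hx'] at hx ⊢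
    exact (key _ _).1 hx
  · intro hx
    obtain ⟨i, y, rfl⟩ := exists_root_eq_of_mem_pairSet hx
    exact (key _ _).2 hx

/-- The whole system also contains the graph of `p`. Over short roots the shift disappears because
`Λ_s` is a group containing the values of `p` there. Over long roots `L` is a translate of `Λ_ℓ`,
which in type `C` need not be `Λ_ℓ` itself. -/
theorem realRoots_eq_pairSet (hE : IsEuclidean P) (hA : ¬ IsTypeA1 P) (hB : ¬ IsTypeB P)
    (D : ExtensionDatum P Y) {p : P.rootSpan ℤ →ₗ[ℤ] Y} (hp : ∀ i, val p i ∈ D.Λ i) :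
    ∃ G L, IsLengthPair P G L ∧ D.realRoots = pairSet p G L ∧ (G : Set Y) = D.Λs ∧
      ∀ i ∈ long P, val p i +ᵥ L = D.Λl := by
  obtain ⟨G, L, h, hGL⟩ := exists_eq_pairSet hE hA hB (Ψ := D.realRoots) (p := p)
    (by
      rintro x ⟨i, -, hi, -⟩
      exact ⟨i, hi⟩)
    (by
      rintro ⟨_, z⟩ ⟨i, -, h1, hi⟩ ⟨_, y⟩ ⟨j, -, h2, hj⟩
      simp only at h1 h2 hi hj
      subst h1 h2
      rw [refl_sumForm hE, mem_realRoots]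
      exact D.sub_mem i j y hj z hi)
    (fun i => mem_realRoots.2 (hp i))
  refine ⟨G, L, h, hGL, ?_, ?_⟩
  · obtain ⟨G', hG', -⟩ := D.exists_isLengthPair hE hA hB
    obtain ⟨i, hi⟩ := short_nonempty P
    have hpi : val p i ∈ G' := by
      rw [← SetLike.mem_coe, hG', ← D.Λ_short hE hi]
      exact hp i
    rw [← hG']
    ext y
    have h1 : (P.root i, y + val p i) ∈ D.realRoots ↔ y + val p i ∈ G' := by
      rw [mem_realRoots, D.Λ_short hE hi, ← hG', SetLike.mem_coe]
    rw [hGL, mem_pairSet_short h hi, add_sub_cancel_right, G'.add_mem_cancel_right hpi] at h1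
    exact h1
  · intro i hi
    ext y
    rw [mem_vadd_set_iff, ← mem_pairSet_long h hi, ← hGL, mem_realRoots, D.Λ_long hE hi]

/-- The maximal proper elements among the length pairs contained in `(G, L)`. -/
def IsMaximalLengthPair (P : RootPairing ι ℝ V N) (G : AddSubgroup Y) (L : Set Y)
    (H : AddSubgroup Y) (S : Set Y) : Prop :=
  H ≤ G ∧ S ⊆ L ∧ ¬ (H = G ∧ S = L) ∧ ∀ H' S', IsLengthPair P H' S' → H ≤ H' → S ⊆ S' →
    H' ≤ G → S' ⊆ L → ¬ (H' = G ∧ S' = L) → H = H' ∧ S = S'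

/-- Any subsystem above `pairSet p H S` still contains the graph of `p`, so it is a pair set for the
same `p`, and inclusions can be tested on pairs. -/
theorem isMaximalRootSubsystem_pairSet_iff (hE : IsEuclidean P) (hA : ¬ IsTypeA1 P)
    (hB : ¬ IsTypeB P) {p : P.rootSpan ℤ →ₗ[ℤ] Y} {G H : AddSubgroup Y} {L S : Set Y}
    (hGL : IsLengthPair P G L) (hHS : IsLengthPair P H S) :
    IsMaximalRootSubsystem (sumForm V Y) (pairSet p G L) (pairSet p H S) ↔
      IsMaximalLengthPair P G L H S := by
  obtain ⟨i₀, -⟩ := short_nonempty P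
  have hsub : ∀ H' S', IsLengthPair P H' S' → H' ≤ G → S' ⊆ L →
      IsRootSubsystem (sumForm V Y) (pairSet p G L) (pairSet p H' S') := fun H' S' h h1 h2 =>
    ⟨(pairSet_subset_iff h hGL).2 ⟨h1, h2⟩, ⟨_, val_mem_pairSet hE h i₀⟩, refl_mem_pairSet hE h⟩
  constructor
  · rintro ⟨h1, h2, h3⟩
    obtain ⟨h4, h5⟩ := (pairSet_subset_iff hHS hGL).1 h1.1
    refine ⟨h4, h5, fun h => h2 (by rw [h.1, h.2]), fun H' S' h' h6 h7 h8 h9 h10 => ?_⟩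
    refine (pairSet_eq_iff hHS h').1 (h3 _ (hsub H' S' h' h8 h9)
      ((pairSet_subset_iff hHS h').2 ⟨h6, h7⟩) fun h => h10 ((pairSet_eq_iff h' hGL).1 h))
  · rintro ⟨h1, h2, h3, h4⟩
    refine ⟨hsub H S hHS h1 h2, fun h => h3 ((pairSet_eq_iff hHS hGL).1 h), ?_⟩
    intro Ψ' hΨ' hle hne
    obtain ⟨H', S', h', rfl⟩ := exists_eq_pairSet hE hA hB (p := p) (Ψ := Ψ')
      (fun x hx => by
        obtain ⟨i, y, rfl⟩ := exists_root_eq_of_mem_pairSet (hΨ'.1 hx)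
        exact ⟨i, rfl⟩)
      hΨ'.2.2 (fun i => hle (val_mem_pairSet hE hHS i))
    obtain ⟨h5, h6⟩ := (pairSet_subset_iff hHS h').1 hle
    obtain ⟨h7, h8⟩ := (pairSet_subset_iff h' hGL).1 hΨ'.1
    obtain ⟨rfl, rfl⟩ := h4 H' S' h' h5 h6 h7 h8 fun h => hne (by rw [h.1, h.2])
    rfl

end PairSet

end LengthPairs

/-! ### Maximal length pairs and the three forms with full gradient -/

section Forms

variable {ι V N Y : Type*} [NormedAddCommGroup V] [InnerProductSpace ℝ V]
  [AddCommGroup N] [Module ℝ N] [AddCommGroup Y] [Module ℝ Y] {P : RootPairing ι ℝ V N}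

theorem IsLengthPair.lacing_smul_subset {G : AddSubgroup Y} {S : Set Y}
    (h : IsLengthPair P G S) : lacing P • (G : Set Y) ⊆ S := by
  rintro _ ⟨g, hg, rfl⟩
  simpa using h.2.2.1 0 h.1 g hg

/-- This is the largest long part below `L` that a given `K` admits, which is why a maximal pair
with `H ≠ G` is determined by `H`. -/
theorem IsLengthPair.inter {G K : AddSubgroup Y} {L : Set Y} (h : IsLengthPair P G L)
    (hK : K ≤ G) (hm : ∀ y ∈ K, lacing P • y ∈ K) : IsLengthPair P K (L ∩ K) := by
  refine ⟨⟨h.1, K.zero_mem⟩, Set.inter_subset_right, fun x hx y hy =>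
    ⟨h.2.2.1 x hx.1 y (hK hy), K.add_mem hx.2 (hm y hy)⟩, fun hC => ?_⟩
  obtain ⟨L', rfl⟩ := h.2.2.2 hC
  exact ⟨L' ⊓ K, rfl⟩

theorem IsLengthPair.mono {G K : AddSubgroup Y} {L : Set Y} (h : IsLengthPair P G L)
    (hK : K ≤ G) (hL : L ⊆ K) : IsLengthPair P K L :=
  ⟨h.1, hL, fun x hx y hy => h.2.2.1 x hx y (hK hy), h.2.2.2⟩

/-- The classification of the maximal length pairs. -/
theorem isMaximalLengthPair_iff {G H : AddSubgroup Y} {L S : Set Y}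
    (hm : ∀ (K : AddSubgroup Y), ∀ y ∈ K, lacing P • y ∈ K)
    (hGL : IsLengthPair P G L) (hHS : IsLengthPair P H S) :
    IsMaximalLengthPair P G L H S ↔
      (H = G ∧ S ⊂ L ∧ ∀ S', IsLengthPair P G S' → S ⊆ S' → S' ⊂ L → S = S') ∨
      (IsMaximalSubgroup (G : Set Y) H ∧ L ⊆ H ∧ S = L) ∨
      (IsMaximalSubgroup (G : Set Y) H ∧ lacing P • (G : Set Y) + (H : Set Y) = G ∧
        S = (H : Set Y) ∩ L) := by
  constructor
  · rintro ⟨h1, h2, h3, h4⟩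
    by_cases hHG : H = G
    · left
      subst hHG
      refine ⟨rfl, ssubset_of_subset_of_ne h2 fun h => h3 ⟨rfl, h⟩, fun S' h5 h6 h7 => ?_⟩
      exact (h4 H S' h5 le_rfl h6 le_rfl h7.1 fun h => h7.ne h.2).2
    right
    have hS : S = L ∩ H := by
      refine (h4 H _ (hGL.inter h1 (hm H)) le_rfl (Set.subset_inter h2 hHS.2.1) h1
        Set.inter_subset_left fun h => hHG h.1).2
    -- A subgroup `K` strictly between `H` and `G` would give the larger proper pair `(K, L ∩ K)`.
    have hmax : IsMaximalSubgroup (G : Set Y) H := by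
      refine ⟨ssubset_of_subset_of_ne h1 fun h => hHG (SetLike.coe_injective h), fun K hK hKG => ?_⟩
      have hKG' : K ≤ G := hKG.1
      refine (h4 K _ (hGL.inter hKG' (hm K)) hK ?_ hKG' Set.inter_subset_left fun h => ?_).1
      · rw [hS]
        exact Set.inter_subset_inter_right _ hK
      · exact hKG.ne (by rw [h.1])
    by_cases hmG : lacing P • (G : Set Y) ⊆ H
    · left
      refine ⟨hmax, ?_, ?_⟩ <;>
      -- When `mG ⊆ H`, the set `S = L ∩ H` is stable even under `mG`, so `(G, S)` is a pair. It
      -- lies strictly above `(H, S)`, hence is not proper, and `S = L`.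
      · have hpair : IsLengthPair P G S := by
          refine ⟨hHS.1, h2.trans hGL.2.1, fun x hx y hy => ?_, hHS.2.2.2⟩
          rw [hS] at hx ⊢
          exact ⟨hGL.2.2.1 x hx.1 y hy, H.add_mem hx.2 (hmG ⟨y, hy, rfl⟩)⟩
        have hSL : S = L := by
          by_contra hne
          exact hHG (h4 G S hpair h1 subset_rfl le_rfl h2 fun h => hne h.2).1
        first
        | exact hSL
        | exact hSL ▸ hHS.2.1
    · right
      refine ⟨hmax, ?_, by rw [hS, Set.inter_comm]⟩
      -- The subgroup `mG + H` is strictly larger than the maximal subgroup `H`, so it is `G`.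
      let K : AddSubgroup Y := G.map (DistribSMul.toAddMonoidHom Y (lacing P)) ⊔ H
      have hKG : K ≤ G := by
        refine sup_le ?_ h1
        rintro _ ⟨g, hg, rfl⟩
        exact hm G g hg
      have hK : K = G := by
        by_contra hne
        have := hmax.2 K le_sup_right
          (ssubset_of_subset_of_ne hKG fun h => hne (SetLike.coe_injective h))
        refine hmG ?_
        rintro _ ⟨g, hg, rfl⟩
        rw [this]
        exact (le_sup_left : _ ≤ K) ⟨g, hg, rfl⟩
      ext y
      rw [← hK, SetLike.mem_coe, AddSubgroup.mem_sup, Set.mem_add, hK]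
      constructor
      · rintro ⟨_, ⟨g, hg, rfl⟩, h, hh, rfl⟩
        exact ⟨_, ⟨g, hg, rfl⟩, h, hh, rfl⟩
      · rintro ⟨_, ⟨g, hg, rfl⟩, h, hh, rfl⟩
        exact ⟨_, ⟨g, hg, rfl⟩, h, hh, rfl⟩
  · have hcases : ∀ H' : AddSubgroup Y, IsMaximalSubgroup (G : Set Y) H → H ≤ H' → H' ≤ G →
        H' = H ∨ H' = G := by
      intro H' hmax h1 h2
      by_contra! hne
      exact hne.1 (hmax.2 H' h1
        (ssubset_of_subset_of_ne h2 fun h => hne.2 (SetLike.coe_injective h))).symm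
    rintro (⟨rfl, h1, h2⟩ | ⟨h1, h2, rfl⟩ | ⟨h1, h2, rfl⟩)
    · refine ⟨le_rfl, h1.1, fun h => h1.ne h.2, fun H' S' h3 h4 h5 h6 h7 h8 => ?_⟩
      obtain rfl : H = H' := le_antisymm h4 h6
      exact ⟨rfl, h2 S' h3 h5 (ssubset_of_subset_of_ne h7 fun h => h8 ⟨rfl, h⟩)⟩
    · refine ⟨h1.1.1, subset_rfl, fun h => h1.1.ne (by rw [h.1]),
        fun H' S' h3 h4 h5 h6 h7 h8 => ?_⟩
      have hS := Set.Subset.antisymm h5 h7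
      rcases hcases H' h1 h4 h6 with rfl | rfl
      · exact ⟨rfl, hS⟩
      · exact absurd ⟨rfl, hS.symm⟩ h8
    · refine ⟨h1.1.1, Set.inter_subset_right, fun h => h1.1.ne (by rw [h.1]),
        fun H' S' h3 h4 h5 h6 h7 h8 => ?_⟩
      rcases hcases H' h1 h4 h6 with rfl | rfl
      · exact ⟨rfl, Set.Subset.antisymm h5 (Set.subset_inter h3.2.1 h7)⟩
      · refine absurd ⟨rfl, Set.Subset.antisymm h7 fun x hx => ?_⟩ h8
        -- Write `x ∈ L` as `m g + h` with `h ∈ H`. Then `h ∈ L` by stability, so `h ∈ H ∩ L ⊆ S'`,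
        -- and adding `m g` back stays in `S'`.
        have hx' : x ∈ lacing P • (H' : Set Y) + (H : Set Y) := by
          rw [h2]
          exact hGL.2.1 hx
        obtain ⟨_, ⟨g, hg, rfl⟩, h, hh, rfl⟩ := hx'
        have hL : h ∈ L := by
          have := hGL.2.2.1 _ hx (-g) (H'.neg_mem hg)
          rw [smul_neg] at this
          simpa [add_comm] using this
        have := h3.2.2.1 h (h5 ⟨hh, hL⟩) g hg
        rwa [add_comm] at this

omit [AddCommGroup Y] [Module ℝ Y] in
theorem graded_congr {J : Set ι} {Z Z' : ι → Set Y} (h : ∀ i ∈ J, Z i = Z' i) :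
    graded P J Z = graded P J Z' := by
  ext x
  constructor <;> rintro ⟨i, hi, h1, h2⟩
  · exact ⟨i, hi, h1, h i hi ▸ h2⟩
  · exact ⟨i, hi, h1, (h i hi).symm ▸ h2⟩

section Fixed

variable [Finite ι] [P.IsRootSystem] [P.IsCrystallographic] [P.IsReduced] [P.IsIrreducible]
  {D : ExtensionDatum P Y} {p : P.rootSpan ℤ →ₗ[ℤ] Y} {G : AddSubgroup Y} {L : Set Y}

omit [Finite ι] [P.IsRootSystem] [P.IsCrystallographic] [P.IsReduced] [P.IsIrreducible] in
theorem vadd_subset_iff (hL : ∀ i ∈ long P, val p i +ᵥ L = D.Λl) {i : ι} (hi : i ∈ long P)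
    {S : Set Y} : val p i +ᵥ S ⊆ D.Λl ↔ S ⊆ L := by
  rw [← hL i hi, Set.vadd_set_subset_vadd_set_iff]

omit [P.IsCrystallographic] [P.IsReduced] in
-- In type `C` the subgroup clause of a length pair is void, and what remains is stability under
-- cosets of `mG`. All conditions on translates reduce to the same one because `Λ_ℓ = p_i + L` for
-- each long root.
theorem isAdmissible_iff (hC : IsTypeC P) (hG : (G : Set Y) = D.Λs)
    (hL : ∀ i ∈ long P, val p i +ᵥ L = D.Λl) {S : Set Y} :
    D.IsAdmissible p S ↔ IsLengthPair P G S ∧ S ⊂ L := by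
  obtain ⟨j, hj⟩ := long_nonempty P
  have hss : ∀ i ∈ long P, val p i +ᵥ S ⊂ D.Λl ↔ S ⊂ L := fun i hi => by
    rw [← hL i hi, ssubset_iff_subset_not_subset, ssubset_iff_subset_not_subset,
      Set.vadd_set_subset_vadd_set_iff, Set.vadd_set_subset_vadd_set_iff]
  rw [IsAdmissible, ← hG]
  constructor
  · rintro ⟨h1, h2, h3, h4⟩
    refine ⟨⟨h3 ⟨0, G.zero_mem, smul_zero _⟩, h1, fun x hx h hh => ?_, fun h => absurd hC h⟩,
      (hss j hj).1 (h4 j hj)⟩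
    exact h2 x hx ⟨_, ⟨h, hh, rfl⟩, rfl⟩
  · rintro ⟨h1, h2⟩
    refine ⟨h1.2.1, ?_, h1.lacing_smul_subset, fun i hi => (hss i hi).2 h2⟩
    rintro x hx _ ⟨_, ⟨h, hh, rfl⟩, rfl⟩
    exact h1.2.2.1 x hx h hh

theorem val_mem_Λl (hE : IsEuclidean P) (hp : ∀ i, val p i ∈ D.Λ i) {j : ι} (hj : j ∈ long P) :
    val p j ∈ D.Λl := by
  rw [← D.Λ_long hE hj]
  exact hp j

theorem isMaximalLongPart_iff (hE : IsEuclidean P) (hA : ¬ IsTypeA1 P) (hB : ¬ IsTypeB P)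
    (hp : ∀ i, val p i ∈ D.Λ i) (hGL : IsLengthPair P G L) (hG : (G : Set Y) = D.Λs)
    (hL : ∀ i ∈ long P, val p i +ᵥ L = D.Λl) {S : Set Y} :
    (D.Λl ≠ lacing P • D.Λs ∧ D.IsMaximalLongPart p S ∧ ∀ i ∈ long P, val p i +ᵥ S ⊆ D.Λl) ↔
      IsLengthPair P G S ∧ S ⊂ L ∧
        ∀ S', IsLengthPair P G S' → S ⊆ S' → S' ⊂ L → S = S' := by
  obtain ⟨j, hj⟩ := long_nonempty P
  have hpj := val_mem_Λl hE hp hj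
  -- If `Λ_ℓ = mΛ_s`, every element of `L` is a difference of two elements of `mG`, so it lies in
  -- `mG ⊆ S`, and `S` cannot be proper.
  have hne : IsLengthPair P G S → S ⊂ L → D.Λl ≠ lacing P • D.Λs := by
    intro h1 h2 heq
    refine h2.2 fun y hy => ?_
    have hy' : val p j + y ∈ D.Λl := by
      rw [← hL j hj]
      exact ⟨y, hy, rfl⟩
    rw [heq, ← hG] at hy' hpj
    obtain ⟨a, ha, ha'⟩ := hy'
    obtain ⟨b, hb, hb'⟩ := hpj
    simp only at ha' hb'
    have : y = lacing P • (a - b) := by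
      rw [smul_sub, ha', hb', add_sub_cancel_left]
    rw [this]
    exact h1.lacing_smul_subset ⟨_, G.sub_mem ha hb, rfl⟩
  by_cases hC : IsTypeC P
  · have hadm := fun S => isAdmissible_iff hC hG hL (S := S)
    simp only [IsMaximalLongPart, hadm, hC, not_true_eq_false, false_imp_iff, and_true,
      true_imp_iff]
    constructor
    · rintro ⟨-, ⟨⟨h1, h2⟩, h3⟩, -⟩
      exact ⟨h1, h2, fun S' h4 h5 h6 => h3 S' ⟨h4, h6⟩ h5⟩
    · rintro ⟨h1, h2, h3⟩
      exact ⟨hne h1 h2, ⟨⟨h1, h2⟩, fun S' h4 h5 => h3 S' h4.1 h5 h4.2⟩,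
        fun i hi => (vadd_subset_iff hL hi).2 h2.1⟩
  -- Outside type `C` the set `Λ_ℓ` is a group containing `p_j`, so translating by `p_j` changes
  -- nothing.
  · have hLΛ : L = D.Λl := by
      obtain ⟨G', -, hG'⟩ := D.exists_isLengthPair hE hA hB
      obtain ⟨K, hK⟩ := hG'.2.2.2 hC
      rw [hK, SetLike.mem_coe] at hpj
      ext y
      have : y ∈ L ↔ val p j + y ∈ D.Λl := by
        rw [← hL j hj, mem_vadd_set_iff, add_sub_cancel_left]
      rw [this, hK, SetLike.mem_coe, SetLike.mem_coe, K.add_mem_cancel_left hpj]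
    have hsubpair : ∀ K : AddSubgroup Y, (K : Set Y) ⊆ L → lacing P • (G : Set Y) ⊆ K →
        IsLengthPair P G K := fun K h1 h2 =>
      ⟨K.zero_mem, h1.trans hGL.2.1, fun x hx h hh => K.add_mem hx (h2 ⟨h, hh, rfl⟩),
        fun _ => ⟨K, rfl⟩⟩
    simp only [IsMaximalLongPart, hC, not_false_eq_true, true_imp_iff, false_imp_iff, true_and,
      ← hLΛ, ← hG] at hne ⊢
    constructor
    · rintro ⟨-, ⟨K, rfl, h1, h2⟩, -⟩
      refine ⟨hsubpair K h1.1.1 h2, h1.1, fun S' h3 h4 h5 => ?_⟩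
      obtain ⟨K', rfl⟩ := h3.2.2.2 hC
      rw [h1.2 K' h4 h5]
    · rintro ⟨h1, h2, h3⟩
      obtain ⟨K, rfl⟩ := h1.2.2.2 hC
      refine ⟨hne h1 h2, ⟨K, rfl, ⟨h2, fun K' h4 h5 => ?_⟩, h1.lacing_smul_subset⟩, fun i hi => ?_⟩
      · exact SetLike.coe_injective
          (h3 K' (hsubpair K' h5.1 (h1.lacing_smul_subset.trans h4)) h4 h5)
      · rw [hLΛ]
        exact (vadd_subset_iff hL hi).2 h2.1

/-- The two sets are translates of each other and both contain `0`, so a subgroup containing one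
also contains the translation vector. -/
theorem subset_iff_Λl_subset (hE : IsEuclidean P) (hp : ∀ i, val p i ∈ D.Λ i)
    (hL : ∀ i ∈ long P, val p i +ᵥ L = D.Λl) {H : AddSubgroup Y} :
    L ⊆ H ↔ D.Λl ⊆ (H : Set Y) := by
  obtain ⟨j, hj⟩ := long_nonempty P
  have hpj := val_mem_Λl hE hp hj
  constructor
  · intro h y hy
    have h0 : (0 : Y) ∈ D.Λl := ⟨j, hj, D.zero_mem_Λ j⟩
    rw [← hL j hj, mem_vadd_set_iff] at hy h0
    have := H.sub_mem (h hy) (h h0)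
    simpa using this
  · intro h y hy
    have hy' : val p j + y ∈ D.Λl := by
      rw [← hL j hj]
      exact ⟨y, hy, rfl⟩
    exact (H.add_mem_cancel_left (h hpj)).1 (h hy')

theorem fullShort_set_eq (hE : IsEuclidean P) (hp : ∀ i, val p i ∈ D.Λ i)
    (hG : (G : Set Y) = D.Λs) (S : Set Y) :
    graded P (short P) (fun _ => D.Λs) ∪ graded P (long P) (fun i => val p i +ᵥ S) =
      pairSet p G S := by
  rw [pairSet]
  congr 1
  refine graded_congr fun i hi => ?_
  have hpi : val p i ∈ G := by
    rw [← SetLike.mem_coe, hG, ← D.Λ_short hE hi]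
    exact hp i
  ext y
  rw [mem_vadd_set_iff, ← hG, SetLike.mem_coe, SetLike.mem_coe, sub_eq_add_neg,
    G.add_mem_cancel_right (G.neg_mem hpi)]

omit [P.IsRootSystem] [P.IsCrystallographic] [P.IsReduced] [P.IsIrreducible] [Finite ι] in
theorem fullLong_set_eq (hL : ∀ i ∈ long P, val p i +ᵥ L = D.Λl) (H : AddSubgroup Y) :
    graded P (short P) (fun i => val p i +ᵥ (H : Set Y)) ∪ graded P (long P) (fun _ => D.Λl) =
      pairSet p H L := by
  rw [pairSet]
  congr 1
  exact graded_congr fun i hi => (hL i hi).symm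

omit [P.IsRootSystem] [P.IsCrystallographic] [P.IsReduced] [P.IsIrreducible] [Finite ι] in
theorem mixed_set_eq (hL : ∀ i ∈ long P, val p i +ᵥ L = D.Λl) (H : AddSubgroup Y) :
    graded P (short P) (fun i => val p i +ᵥ (H : Set Y)) ∪
      graded P (long P) (fun i => (val p i +ᵥ (H : Set Y)) ∩ D.Λl) =
      pairSet p H ((H : Set Y) ∩ L) := by
  rw [pairSet]
  congr 1
  refine graded_congr fun i hi => ?_
  rw [Set.vadd_set_inter, hL i hi]

end Fixed

section Classification

variable [Finite ι] [P.IsRootSystem] [P.IsCrystallographic] [P.IsReduced] [P.IsIrreducible]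
  {D : ExtensionDatum P Y} {Ψ : Set (V × Y)}

/-- Maximal root subsystems with full gradient have one of the three forms. -/
theorem form_of_isMaximal (hE : IsEuclidean P) (hA : ¬ IsTypeA1 P) (hB : ¬ IsTypeB P)
    (hmax : IsMaximalRootSubsystem (sumForm V Y) D.realRoots Ψ)
    (hfull : ∀ i, ∃ y, (P.root i, y) ∈ Ψ) :
    D.FullShortForm Ψ ∨ D.FullLongForm Ψ ∨ D.MixedForm Ψ := by
  obtain ⟨p, hpΨ⟩ := exists_val_mem hE hmax.1.2.2 hfull
  have hp : ∀ i, val p i ∈ D.Λ i := fun i => mem_realRoots.1 (hmax.1.1 (hpΨ i))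
  have hfib : ∀ i, val p i ∈ D.fiber Ψ i := fun i => ⟨hp i, hpΨ i⟩
  obtain ⟨G, L, hGL, hΦ, hG, hL⟩ := realRoots_eq_pairSet hE hA hB D hp
  obtain ⟨H, S, hHS, rfl⟩ := exists_eq_pairSet hE hA hB
    (fun x hx => by
      obtain ⟨i, -, hi, -⟩ := hmax.1.1 hx
      exact ⟨i, hi⟩) hmax.1.2.2 hpΨ
  rw [hΦ, isMaximalRootSubsystem_pairSet_iff hE hA hB hGL hHS,
    isMaximalLengthPair_iff (fun K y hy => lacing_smul_mem hE K hy) hGL hHS] at hmax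
  rcases hmax with ⟨rfl, h1⟩ | ⟨h1, h2, rfl⟩ | ⟨h1, h2, rfl⟩
  · obtain ⟨h2, h3, h4⟩ := (isMaximalLongPart_iff hE hA hB hp hGL hG hL).2 ⟨hHS, h1⟩
    exact Or.inl ⟨h2, p, hfib, S, h3, h4, (fullShort_set_eq hE hp hG S).symm⟩
  · have h3 := (subset_iff_Λl_subset hE hp hL).1 h2
    refine Or.inr (Or.inl ⟨fun h => ?_, p, hfib, H, hG ▸ h1, h3, (fullLong_set_eq hL H).symm⟩)
    refine h1.1.2 ?_
    rw [hG, ← h]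
    exact (AddSubgroup.closure_le H).2 h3
  · refine Or.inr (Or.inr ⟨p, hfib, H, hG ▸ h1, hG ▸ h2, (mixed_set_eq hL H).symm⟩)

theorem isMaximal_of_form (hE : IsEuclidean P) (hA : ¬ IsTypeA1 P) (hB : ¬ IsTypeB P)
    (h : D.FullShortForm Ψ ∨ D.FullLongForm Ψ ∨ D.MixedForm Ψ) :
    IsMaximalRootSubsystem (sumForm V Y) D.realRoots Ψ := by
  have hm := fun (K : AddSubgroup Y) y (hy : y ∈ K) => lacing_smul_mem (P := P) hE K hy
  rcases h with ⟨h1, p, hfib, S, h2, h3, rfl⟩ | ⟨-, p, hfib, H, h1, h2, rfl⟩ |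
    ⟨p, hfib, H, h1, h2, rfl⟩ <;>
  obtain ⟨G, L, hGL, hΦ, hG, hL⟩ := realRoots_eq_pairSet hE hA hB D fun i => (hfib i).1
  · obtain ⟨h4, h5⟩ := (isMaximalLongPart_iff hE hA hB (fun i => (hfib i).1) hGL hG hL).1
      ⟨h1, h2, h3⟩
    rw [fullShort_set_eq hE (fun i => (hfib i).1) hG, hΦ,
      isMaximalRootSubsystem_pairSet_iff hE hA hB hGL h4, isMaximalLengthPair_iff hm hGL h4]
    exact Or.inl ⟨rfl, h5⟩
  · rw [← hG] at h1
    have h3 := (subset_iff_Λl_subset hE (fun i => (hfib i).1) hL).2 h2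
    have h4 := hGL.mono h1.1.1 h3
    rw [fullLong_set_eq hL, hΦ,
      isMaximalRootSubsystem_pairSet_iff hE hA hB hGL h4, isMaximalLengthPair_iff hm hGL h4]
    exact Or.inr (Or.inl ⟨h1, h3, rfl⟩)
  · rw [← hG] at h1 h2
    have h4 := hGL.inter h1.1.1 (hm H)
    rw [Set.inter_comm] at h4
    rw [mixed_set_eq hL, hΦ,
      isMaximalRootSubsystem_pairSet_iff hE hA hB hGL h4, isMaximalLengthPair_iff hm hGL h4]
    exact Or.inr (Or.inr ⟨h1, h2, rfl⟩)

end Classification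

end Forms

/-! ### Proper gradients: lifts of maximal subsystems -/

section Lifts

variable {ι V N Y : Type*} [NormedAddCommGroup V] [InnerProductSpace ℝ V]
  [AddCommGroup N] [Module ℝ N] [AddCommGroup Y] [Module ℝ Y] {P : RootPairing ι ℝ V N}

omit [Module ℝ Y] in
theorem val_zero (i : ι) : val (0 : P.rootSpan ℤ →ₗ[ℤ] Y) i = 0 := rfl

theorem isRootSubsystem_image_iff (hE : IsEuclidean P) {J : Set ι} :
    IsRootSubsystem (innerₗ V) (Set.range P.root) (P.root '' J) ↔
      J.Nonempty ∧ ∀ i ∈ J, ∀ j ∈ J, P.reflectionPerm i j ∈ J := by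
  simp only [IsRootSubsystem, Set.image_subset_range, true_and, Set.image_nonempty,
    Set.forall_mem_image, hE.refl_root_root, P.root.injective.mem_set_image]

/-- Every proper root subsystem of a finite root system is contained in a maximal one. -/
theorem exists_maximal_image [Finite ι] {J : Set ι}
    (hJ : IsRootSubsystem (innerₗ V) (Set.range P.root) (P.root '' J)) (hne : J ≠ Set.univ) :
    ∃ K, J ⊆ K ∧ K ≠ Set.univ ∧
      IsMaximalRootSubsystem (innerₗ V) (Set.range P.root) (P.root '' K) := by
  have huniv : ∀ K : Set ι, P.root '' K = Set.range P.root ↔ K = Set.univ := fun K => by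
    rw [← Set.image_univ, P.root.injective.image_injective.eq_iff]
  obtain ⟨K, hJK, hK⟩ := (Set.toFinite {K : Set ι |
    IsRootSubsystem (innerₗ V) (Set.range P.root) (P.root '' K) ∧ K ≠ Set.univ}).exists_le_maximal
    ⟨hJ, hne⟩
  refine ⟨K, hJK, hK.1.2, hK.1.1, fun h => hK.1.2 ((huniv K).1 h), fun Ψ' h1 h2 h3 => ?_⟩
  obtain ⟨K', rfl⟩ := Set.subset_range_iff_exists_image_eq.1 h1.1
  have h4 : K ⊆ K' := (Set.image_subset_image_iff P.root.injective).1 h2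
  rw [Set.Subset.antisymm h4 (hK.2 ⟨h1, fun h => h3 ((huniv K').2 h)⟩ h4)]

theorem gradient_graded {D : ExtensionDatum P Y} (J : Set ι) :
    D.gradient (graded P J D.Λ) = J := by
  ext i
  constructor
  · rintro ⟨y, -, hy⟩
    exact (mem_graded_root.1 hy).1
  · intro hi
    obtain ⟨y, hy⟩ := D.nonempty i
    exact ⟨y, hy, mem_graded_root.2 ⟨hi, hy⟩⟩

theorem mem_gradient_of_subset {D : ExtensionDatum P Y} {Ψ : Set (V × Y)} (h : Ψ ⊆ D.realRoots)
    {i : ι} : i ∈ D.gradient Ψ ↔ ∃ y, (P.root i, y) ∈ Ψ :=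
  ⟨fun ⟨y, _, hy⟩ => ⟨y, hy⟩, fun ⟨y, hy⟩ => ⟨y, mem_realRoots.1 (h hy), hy⟩⟩

theorem subset_graded_gradient {D : ExtensionDatum P Y} {Ψ : Set (V × Y)} (h : Ψ ⊆ D.realRoots) :
    Ψ ⊆ graded P (D.gradient Ψ) D.Λ := by
  intro x hx
  obtain ⟨i, -, hi, hy⟩ := h hx
  have hx' : x = (P.root i, x.2) := Prod.ext hi rfl
  exact ⟨i, ⟨x.2, hy, hx' ▸ hx⟩, hi, hy⟩

theorem graded_subset_realRoots {D : ExtensionDatum P Y} {J : Set ι} :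
    graded P J D.Λ ⊆ D.realRoots := by
  rintro x ⟨i, -, h⟩
  exact ⟨i, trivial, h⟩

theorem isRootSubsystem_gradient (hE : IsEuclidean P) {D : ExtensionDatum P Y} {Ψ : Set (V × Y)}
    (h : IsRootSubsystem (sumForm V Y) D.realRoots Ψ) :
    IsRootSubsystem (innerₗ V) (Set.range P.root) (P.root '' D.gradient Ψ) := by
  rw [isRootSubsystem_image_iff hE]
  refine ⟨?_, fun i hi j hj => ?_⟩
  · obtain ⟨x, hx⟩ := h.2.1
    obtain ⟨i, hi, -⟩ := subset_graded_gradient h.1 hx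
    exact ⟨i, hi⟩
  · rw [mem_gradient_of_subset h.1] at hi hj ⊢
    obtain ⟨z, hz⟩ := hi
    obtain ⟨y, hy⟩ := hj
    have := h.2.2 _ hz _ hy
    rw [refl_sumForm hE] at this
    exact ⟨_, this⟩

theorem isRootSubsystem_graded (hE : IsEuclidean P) (D : ExtensionDatum P Y) {J : Set ι}
    (h : IsRootSubsystem (innerₗ V) (Set.range P.root) (P.root '' J)) :
    IsRootSubsystem (sumForm V Y) D.realRoots (graded P J D.Λ) := by
  rw [isRootSubsystem_image_iff hE] at h
  obtain ⟨⟨i, hi⟩, h2⟩ := h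
  refine ⟨graded_subset_realRoots, ?_, ?_⟩
  · obtain ⟨y, hy⟩ := D.nonempty i
    exact ⟨_, mem_graded_root.2 ⟨hi, hy⟩⟩
  · rintro ⟨_, z⟩ ⟨i, hi, rfl, hz⟩ ⟨_, y⟩ ⟨j, hj, rfl, hy⟩
    rw [refl_sumForm hE]
    exact mem_graded_root.2 ⟨h2 i hi j hj, D.sub_mem i j y hy z hz⟩

theorem graded_ne_realRoots {D : ExtensionDatum P Y} {J : Set ι} (hJ : J ≠ Set.univ) :
    graded P J D.Λ ≠ D.realRoots := by
  intro h
  refine hJ ?_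
  rw [← gradient_graded (D := D) J, h, realRoots, gradient_graded]

theorem IsMaximalLift.eq_graded {D : ExtensionDatum P Y} {Ψ : Set (V × Y)}
    (h : D.IsMaximalLift Ψ) (hΨ : Ψ ⊆ D.realRoots) : Ψ = graded P (D.gradient Ψ) D.Λ := by
  refine Set.Subset.antisymm (subset_graded_gradient hΨ) ?_
  rintro x ⟨i, hi, hx, hy⟩
  rw [← h.2 i hi] at hy
  have hx' : x = (P.root i, x.2) := Prod.ext hx rfl
  rw [hx']
  exact hy.2

variable [Finite ι] [P.IsRootSystem] [P.IsCrystallographic] [P.IsReduced] [P.IsIrreducible]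
  {D : ExtensionDatum P Y} {Ψ : Set (V × Y)}

omit [P.IsRootSystem] [P.IsCrystallographic] [P.IsReduced] [P.IsIrreducible] in
-- `Ψ` lies in the lift of its gradient, hence in the lift of a maximal subsystem `K` above it. That
-- lift is a proper subsystem, so it equals `Ψ`.
theorem isMaximalLift_of_isMaximal (hE : IsEuclidean P)
    (hmax : IsMaximalRootSubsystem (sumForm V Y) D.realRoots Ψ)
    (hne : D.gradient Ψ ≠ Set.univ) : D.IsMaximalLift Ψ := by
  obtain ⟨K, hK1, hK2, hK3⟩ := exists_maximal_image (isRootSubsystem_gradient hE hmax.1) hne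
  have hΨ : Ψ = graded P K D.Λ := by
    refine hmax.2.2 _ (isRootSubsystem_graded hE D hK3.1) ?_ (graded_ne_realRoots hK2)
    refine (subset_graded_gradient hmax.1.1).trans ?_
    rintro x ⟨i, hi, h⟩
    exact ⟨i, hK1 hi, h⟩
  have hg : D.gradient Ψ = K := by rw [hΨ, gradient_graded]
  refine ⟨hg ▸ hK3, fun i hi => ?_⟩
  rw [hg] at hi
  ext y
  refine ⟨fun h => h.1, fun h => ⟨h, ?_⟩⟩
  rw [hΨ]
  exact mem_graded_root.2 ⟨hi, h⟩

/-- A maximal root subsystem does not have proper gradient if it is contained in a root subsystem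
with full gradient. -/
theorem gradient_eq_univ_of_subset_pairSet (hE : IsEuclidean P) (hA : ¬ IsTypeA1 P)
    (hB : ¬ IsTypeB P) (hmax : IsMaximalRootSubsystem (sumForm V Y) D.realRoots Ψ)
    {H : AddSubgroup Y} {S : Set Y} (hHS : IsLengthPair P H S) (hH : (H : Set Y) ⊆ D.Λs)
    (hS : S ⊆ D.Λl) (hne : ¬ ((H : Set Y) = D.Λs ∧ S = D.Λl))
    (hsub : Ψ ⊆ pairSet (P := P) 0 H S) : D.gradient Ψ = Set.univ := by
  -- For `p = 0` there is no shift, and `L` is `Λ_ℓ` in every type.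
  obtain ⟨G, L, hGL, hΦ, hG, hL⟩ := realRoots_eq_pairSet hE hA hB D (p := 0)
    (fun i => D.zero_mem_Λ i)
  obtain ⟨j, hj⟩ := long_nonempty P
  have hLΛ : L = D.Λl := by
    rw [← hL j hj, val_zero, zero_vadd]
  rw [← hG, ← hLΛ] at hne
  rw [← hG] at hH
  rw [← hLΛ] at hS
  have hle : pairSet (P := P) 0 H S ⊆ D.realRoots := by
    rw [hΦ]
    exact (pairSet_subset_iff hHS hGL).2 ⟨hH, hS⟩
  have hΨ := hmax.2.2 _ ⟨hle, ⟨_, val_mem_pairSet hE hHS j⟩, refl_mem_pairSet hE hHS⟩ hsub (by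
    rw [hΦ, ne_eq, pairSet_eq_iff hHS hGL]
    exact fun h => hne ⟨by rw [h.1], h.2⟩)
  rw [Set.eq_univ_iff_forall]
  intro i
  rw [mem_gradient_of_subset hmax.1.1, hΨ]
  exact ⟨_, val_mem_pairSet hE hHS i⟩

/-- Otherwise the pair `(Λ_s, mΛ_s)` is proper, and its subsystem with full gradient contains all
roots over the short ones. -/
theorem Λl_eq_of_gradient_eq_short (hE : IsEuclidean P) (hA : ¬ IsTypeA1 P)
    (hB : ¬ IsTypeB P) (hmax : IsMaximalRootSubsystem (sumForm V Y) D.realRoots Ψ)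
    (hne : D.gradient Ψ ≠ Set.univ) (hs : D.gradient Ψ = short P) :
    D.Λl = lacing P • D.Λs := by
  by_contra hcon
  obtain ⟨G, hG, hGL⟩ := D.exists_isLengthPair hE hA hB
  have hpair : IsLengthPair P G (lacing P • (G : Set Y)) := by
    refine ⟨⟨0, G.zero_mem, smul_zero _⟩, ?_, ?_, fun _ =>
      ⟨G.map (DistribSMul.toAddMonoidHom Y (lacing P)), rfl⟩⟩
    · rintro _ ⟨g, hg, rfl⟩
      exact lacing_smul_mem hE G hg
    · rintro _ ⟨g, hg, rfl⟩ h hh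
      exact ⟨g + h, G.add_mem hg hh, smul_add _ _ _⟩
  refine hne (gradient_eq_univ_of_subset_pairSet hE hA hB hmax hpair hG.le
    hGL.lacing_smul_subset (fun h => hcon (by rw [← h.2, hG])) ?_)
  refine (subset_graded_gradient hmax.1.1).trans ?_
  rintro x ⟨i, hi, hx, hy⟩
  rw [hs] at hi
  refine Or.inl ⟨i, hi, hx, ?_⟩
  beta_reduce
  rwa [val_zero, zero_vadd, hG, ← D.Λ_short hE hi]

/-- Otherwise the proper pair `(⟨Λ_ℓ⟩, Λ_ℓ)` gives a subsystem with full gradient containing all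
roots over the long ones. -/
theorem closure_Λl_eq_of_gradient_eq_long (hE : IsEuclidean P) (hA : ¬ IsTypeA1 P)
    (hB : ¬ IsTypeB P) (hmax : IsMaximalRootSubsystem (sumForm V Y) D.realRoots Ψ)
    (hne : D.gradient Ψ ≠ Set.univ) (hl : D.gradient Ψ = long P) :
    (AddSubgroup.closure D.Λl : Set Y) = D.Λs := by
  by_contra hcon
  obtain ⟨G, hG, hGL⟩ := D.exists_isLengthPair hE hA hB
  have hle : AddSubgroup.closure D.Λl ≤ G := (AddSubgroup.closure_le G).2 hGL.2.1
  refine hne (gradient_eq_univ_of_subset_pairSet hE hA hB hmax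
    (hGL.mono hle AddSubgroup.subset_closure) (hG ▸ hle) subset_rfl (fun h => hcon h.1) ?_)
  refine (subset_graded_gradient hmax.1.1).trans ?_
  rintro x ⟨i, hi, hx, hy⟩
  rw [hl] at hi
  refine Or.inr ⟨i, hi, hx, ?_⟩
  beta_reduce
  rwa [val_zero, zero_vadd, ← D.Λ_long hE hi]

omit [Finite ι] [P.IsRootSystem] [P.IsCrystallographic] [P.IsReduced] [P.IsIrreducible] in
/-- If all roots are short, then all roots are long. -/
theorem long_eq_univ_iff_short_eq_univ : long P = Set.univ ↔ short P = Set.univ := by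
  simp only [Set.eq_univ_iff_forall, long, short, Set.mem_ofPred_eq]
  exact forall_comm

/-- A lift of a maximal root subsystem is maximal under the conditions on short and long roots. -/
theorem isMaximal_of_isMaximalLift (hE : IsEuclidean P) (hA : ¬ IsTypeA1 P)
    (hB : ¬ IsTypeB P) (hΨ : Ψ ⊆ D.realRoots) (h : D.IsMaximalLift Ψ)
    (hcond : (D.gradient Ψ ≠ short P ∧ D.gradient Ψ ≠ long P) ∨
      (D.gradient Ψ = short P ∧ D.Λl = lacing P • D.Λs) ∨
      (D.gradient Ψ = long P ∧ (AddSubgroup.closure D.Λl : Set Y) = D.Λs)) :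
    IsMaximalRootSubsystem (sumForm V Y) D.realRoots Ψ := by
  have heq := h.eq_graded hΨ
  have hJ := h.1
  set J := D.gradient Ψ with hJdef
  have hJu : J ≠ Set.univ := fun hu => hJ.2.1 (by rw [hu, Set.image_univ])
  have hmaxJ : ∀ K : Set ι, IsRootSubsystem (innerₗ V) (Set.range P.root) (P.root '' K) →
      J ⊆ K → K ≠ Set.univ → J = K := fun K h1 h2 h3 => by
    refine P.root.injective.image_injective (hJ.2.2 _ h1 (Set.image_mono h2) fun h4 => h3 ?_)
    rwa [← Set.image_univ, P.root.injective.image_injective.eq_iff] at h4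
  rw [heq]
  refine ⟨isRootSubsystem_graded hE D hJ.1, graded_ne_realRoots hJu, fun Ψ' h1 h2 h3 => ?_⟩
  have hsub : J ⊆ D.gradient Ψ' := fun i hi => by
    obtain ⟨y, hy⟩ := D.nonempty i
    exact ⟨y, hy, h2 (mem_graded_root.2 ⟨hi, hy⟩)⟩
  by_cases hu : D.gradient Ψ' = Set.univ
  · exfalso
    obtain ⟨p, hpΨ⟩ := exists_val_mem hE h1.2.2 fun i =>
      (mem_gradient_of_subset h1.1).1 (hu ▸ Set.mem_univ i)
    have hp : ∀ i, val p i ∈ D.Λ i := fun i => mem_realRoots.1 (h1.1 (hpΨ i))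
    obtain ⟨G, L, hGL, hΦ, hG, hL⟩ := realRoots_eq_pairSet hE hA hB D hp
    obtain ⟨H, S, hHS, rfl⟩ := exists_eq_pairSet hE hA hB
      (fun x hx => by
        obtain ⟨i, -, hi, -⟩ := h1.1 hx
        exact ⟨i, hi⟩) h1.2.2 hpΨ
    rw [hΦ] at h1 h3
    obtain ⟨hHG, hSL⟩ := (pairSet_subset_iff hHS hGL).1 h1.1
    -- `Ψ'` has complete fibres over `J`. Hence one short root in `J` forces `H = G`, and one long
    -- root forces `S = L`.
    have hfull : ∀ i ∈ J, ∀ y, (P.root i, y) ∈ pairSet p G L → (P.root i, y) ∈ pairSet p H S := by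
      intro i hi y hy
      rw [← hΦ, mem_realRoots] at hy
      exact h2 (mem_graded_root.2 ⟨hi, hy⟩)
    have hshort : ∀ i ∈ J, i ∈ short P → H = G := by
      intro i hi his
      refine le_antisymm hHG fun x hx => ?_
      have := hfull i hi (x + val p i) ((mem_pairSet_short hGL his).2 (by simpa using hx))
      simpa using (mem_pairSet_short hHS his).1 this
    have hlong : ∀ i ∈ J, i ∈ long P → S = L := by
      intro i hi hil
      refine Set.Subset.antisymm hSL fun x hx => ?_
      have := hfull i hi (x + val p i) ((mem_pairSet_long hGL hil).2 (by simpa using hx))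
      simpa using (mem_pairSet_long hHS hil).1 this
    have hne : ¬ (H = G ∧ S = L) := fun h => h3 (by rw [h.1, h.2])
    obtain ⟨a, ha⟩ := (isRootSubsystem_image_iff hE).1 hJ.1 |>.1
    obtain ⟨j, hj⟩ := long_nonempty P
    have hpj := val_mem_Λl hE hp hj
    rcases hcond with ⟨hc1, hc2⟩ | ⟨hc1, hc2⟩ | ⟨hc1, hc2⟩
    -- If `J` had only long roots, maximality would make it the subsystem of all long roots;
    -- symmetrically for short roots. So `J` meets both lengths.
    · have hex1 : ∃ i ∈ J, i ∈ short P := by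
        by_contra! hcon
        have hJl : J ⊆ long P := fun i hi => (hE.mem_short_or_mem_long i).resolve_left (hcon i hi)
        refine hc2 (hmaxJ _ ?_ hJl fun hlu => ?_)
        · exact (isRootSubsystem_image_iff hE).2 ⟨long_nonempty P, fun i _ j hj =>
            (hE.reflectionPerm_mem_long i).2 hj⟩
        · rw [long_eq_univ_iff_short_eq_univ] at hlu
          exact hcon a ha (hlu ▸ Set.mem_univ a)
      have hex2 : ∃ i ∈ J, i ∈ long P := by
        by_contra! hcon
        have hJl : J ⊆ short P := fun i hi => (hE.mem_short_or_mem_long i).resolve_right (hcon i hi)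
        refine hc1 (hmaxJ _ ?_ hJl fun hlu => ?_)
        · exact (isRootSubsystem_image_iff hE).2 ⟨short_nonempty P, fun i _ j hj =>
            (hE.reflectionPerm_mem_short i).2 hj⟩
        · rw [← long_eq_univ_iff_short_eq_univ] at hlu
          exact hcon a ha (hlu ▸ Set.mem_univ a)
      obtain ⟨i, hi, his⟩ := hex1
      obtain ⟨k, hk, hkl⟩ := hex2
      exact hne ⟨hshort i hi his, hlong k hk hkl⟩
    -- With `H = G`, the set `S` contains `mG`, and `Λ_ℓ = mΛ_s` places `L` inside `mG`.
    · have hHG' := hshort a ha (hc1 ▸ ha)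
      refine hne ⟨hHG', Set.Subset.antisymm hSL fun y hy => ?_⟩
      have hy' : val p j + y ∈ D.Λl := by
        rw [← hL j hj]
        exact ⟨y, hy, rfl⟩
      rw [hc2, ← hG, ← hHG'] at hy' hpj
      obtain ⟨b, hb, hb'⟩ := hy'
      obtain ⟨c, hc, hc'⟩ := hpj
      simp only at hb' hc'
      have : y = lacing P • (b - c) := by
        rw [smul_sub, hb', hc', add_sub_cancel_left]
      rw [this]
      exact hHS.lacing_smul_subset ⟨_, H.sub_mem hb hc, rfl⟩
    -- With `S = L`, the group `H` contains `Λ_ℓ`, hence the group it generates, which is `G`.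
    · have hSL' := hlong a ha (hc1 ▸ ha)
      refine hne ⟨le_antisymm hHG ?_, hSL'⟩
      have hΛH := (subset_iff_Λl_subset hE hp hL (H := H)).1 (hSL' ▸ hHS.2.1)
      intro x hx
      rw [← SetLike.mem_coe, hG, ← hc2] at hx
      exact (AddSubgroup.closure_le H).2 hΛH hx
  · have hJ' := hmaxJ _ (isRootSubsystem_gradient hE h1) hsub hu
    refine Set.Subset.antisymm h2 ?_
    rw [hJ']
    exact subset_graded_gradient h1.1

/-- The classification of the maximal root subsystems of the real roots of an affine reflection
system constructed from an extension datum. -/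
theorem isMaximalRootSubsystem_realRoots_iff (hE : IsEuclidean P) (hA : ¬ IsTypeA1 P)
    (hB : ¬ IsTypeB P) (hΨ : Ψ ⊆ D.realRoots) :
    IsMaximalRootSubsystem (sumForm V Y) D.realRoots Ψ ↔
      (D.FullShortForm Ψ ∨ D.FullLongForm Ψ ∨ D.MixedForm Ψ) ∨
      (D.IsMaximalLift Ψ ∧
        ((D.gradient Ψ ≠ short P ∧ D.gradient Ψ ≠ long P) ∨
          (D.gradient Ψ = short P ∧ D.Λl = lacing P • D.Λs) ∨
          (D.gradient Ψ = long P ∧ (AddSubgroup.closure D.Λl : Set Y) = D.Λs))) := by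
  constructor
  · intro hmax
    by_cases hu : D.gradient Ψ = Set.univ
    · exact Or.inl (form_of_isMaximal hE hA hB hmax fun i =>
        (mem_gradient_of_subset hΨ).1 (hu ▸ Set.mem_univ i))
    · refine Or.inr ⟨isMaximalLift_of_isMaximal hE hmax hu, ?_⟩
      by_cases hs : D.gradient Ψ = short P
      · exact Or.inr (Or.inl ⟨hs, Λl_eq_of_gradient_eq_short hE hA hB hmax hu hs⟩)
      by_cases hl : D.gradient Ψ = long P
      · exact Or.inr (Or.inr ⟨hl, closure_Λl_eq_of_gradient_eq_long hE hA hB hmax hu hl⟩)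
      exact Or.inl ⟨hs, hl⟩
  · rintro (h | ⟨h1, h2⟩)
    · exact isMaximal_of_form hE hA hB h
    · exact isMaximal_of_isMaximalLift hE hA hB hΨ h1 h2

omit [P.IsReduced] [P.IsIrreducible] in
theorem real_toSystem (hE : IsEuclidean P) : (D.toSystem hE).real = D.realRoots := by
  ext x
  constructor
  · rintro ⟨h1, h2⟩
    obtain ⟨i, hi, hy⟩ := D.exists_index h1 h2
    exact ⟨i, trivial, hi, hy⟩
  · rintro ⟨i, -, hi, hy⟩
    refine ⟨Or.inr ⟨i, trivial, hi, hy⟩, ?_⟩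
    change sumForm V Y x x ≠ 0
    rw [sumForm_apply, hi]
    exact (inner_root_pos P i).ne'

end Lifts

end ExtensionDatum

/-! ### Transport along isomorphisms of affine reflection systems -/

namespace AffineReflectionSystem

variable {X X' : Type*} [AddCommGroup X] [Module ℝ X] [AddCommGroup X'] [Module ℝ X']
  {A : AffineReflectionSystem X} {A' : AffineReflectionSystem X'}

theorem refl_self (B : LinearMap.BilinForm ℝ X) {α : X} (h : B α α ≠ 0) :
    refl B α α = -α := by
  rw [refl, coPairing, mul_div_assoc, div_self h]
  module

theorem refl_of_form_eq_zero (B : LinearMap.BilinForm ℝ X) {α : X} (h : B α α = 0) (x : X) :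
    refl B α x = x := by
  simp [refl, coPairing, h]

/-- An isomorphism respects reflections but not necessarily forms; this recognises real roots from
the reflection alone. -/
theorem refl_eq_neg_iff (B : LinearMap.BilinForm ℝ X) {α : X} (h0 : α ≠ 0) :
    refl B α α = -α ↔ B α α ≠ 0 := by
  refine ⟨fun h hB => h0 ?_, refl_self B⟩
  rw [refl_of_form_eq_zero B hB] at h
  have h2 : (2 : ℝ) • α = 0 := by
    rw [two_smul]
    nth_rewrite 1 [h]
    exact neg_add_cancel α
  exact (smul_eq_zero.1 h2).resolve_left two_ne_zero

namespace Iso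

theorem form_ne_zero_iff (e : A.Iso A') {α : X} (hα : α ∈ A.roots) :
    A'.form (e.toEquiv α) (e.toEquiv α) ≠ 0 ↔ A.form α α ≠ 0 := by
  by_cases h0 : α = 0
  · simp [h0]
  · rw [← refl_eq_neg_iff _ h0, ← refl_eq_neg_iff _ (e.toEquiv.map_ne_zero_iff.2 h0),
      ← e.map_refl α hα, ← map_neg, e.toEquiv.injective.eq_iff]

theorem image_real (e : A.Iso A') : e.toEquiv '' A.real = A'.real := by
  ext y
  constructor
  · rintro ⟨α, ⟨h1, h2⟩, rfl⟩
    exact ⟨e.image_roots ▸ Set.mem_image_of_mem _ h1, (e.form_ne_zero_iff h1).2 h2⟩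
  · rintro ⟨h1, h2⟩
    rw [← e.image_roots] at h1
    obtain ⟨α, hα, rfl⟩ := h1
    exact ⟨α, ⟨hα, (e.form_ne_zero_iff hα).1 h2⟩, rfl⟩

theorem isRootSubsystem_image_iff (e : A.Iso A') {Ψ : Set X} :
    IsRootSubsystem A'.form A'.real (e.toEquiv '' Ψ) ↔ IsRootSubsystem A.form A.real Ψ := by
  rw [IsRootSubsystem, IsRootSubsystem, ← e.image_real,
    Set.image_subset_image_iff e.toEquiv.injective, Set.image_nonempty]
  refine and_congr_right fun hΨ => and_congr_right fun _ => ?_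
  simp only [Set.forall_mem_image]
  refine forall₂_congr fun α hα => forall₂_congr fun β _ => ?_
  rw [← e.map_refl α (hΨ hα).1, e.toEquiv.injective.mem_set_image]

theorem isMaximalRootSubsystem_image_iff (e : A.Iso A') {Ψ : Set X} :
    IsMaximalRootSubsystem A'.form A'.real (e.toEquiv '' Ψ) ↔
      IsMaximalRootSubsystem A.form A.real Ψ := by
  have himg := e.toEquiv.injective.image_injective
  rw [IsMaximalRootSubsystem, IsMaximalRootSubsystem, e.isRootSubsystem_image_iff]
  refine and_congr_right fun _ => and_congr ?_ ?_
  · rw [← e.image_real, himg.ne_iff]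
  · rw [(Set.image_surjective.2 e.toEquiv.surjective).forall]
    refine forall_congr' fun Ψ' => ?_
    rw [e.isRootSubsystem_image_iff, Set.image_subset_image_iff e.toEquiv.injective,
      ← e.image_real, himg.ne_iff, himg.eq_iff]

end Iso

end AffineReflectionSystem

end AffRefl

theorem theorem4p4 {ι V N Y X : Type*} [Finite ι]
    [NormedAddCommGroup V] [InnerProductSpace ℝ V] [AddCommGroup N] [Module ℝ N]
    [AddCommGroup Y] [Module ℝ Y] [FiniteDimensional ℝ Y]
    [AddCommGroup X] [Module ℝ X] [FiniteDimensional ℝ X]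
    (P : RootPairing ι ℝ V N) [P.IsRootSystem] [P.IsCrystallographic] [P.IsReduced]
    [P.IsIrreducible] (hE : AffRefl.IsEuclidean P)
    (hA : ¬ AffRefl.IsTypeA1 P) (hB : ¬ AffRefl.IsTypeB P)
    (D : AffRefl.ExtensionDatum P Y)
    (A : AffRefl.AffineReflectionSystem X) (e : A.Iso (D.toSystem hE))
    (Ψ : Set X) (hΨ : Ψ ⊆ A.real) :
    AffRefl.IsMaximalRootSubsystem A.form A.real Ψ ↔
      (D.FullShortForm (e.toEquiv '' Ψ) ∨ D.FullLongForm (e.toEquiv '' Ψ) ∨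
        D.MixedForm (e.toEquiv '' Ψ)) ∨
      (D.IsMaximalLift (e.toEquiv '' Ψ) ∧
        ((D.gradient (e.toEquiv '' Ψ) ≠ AffRefl.short P ∧
            D.gradient (e.toEquiv '' Ψ) ≠ AffRefl.long P) ∨
          (D.gradient (e.toEquiv '' Ψ) = AffRefl.short P ∧
            D.Λl = AffRefl.lacing P • D.Λs) ∨
          (D.gradient (e.toEquiv '' Ψ) = AffRefl.long P ∧
            (AddSubgroup.closure D.Λl : Set Y) = D.Λs))) := by
  have hreal : (D.toSystem hE).real = D.realRoots := AffRefl.ExtensionDatum.real_toSystem hE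
  have hsub : e.toEquiv '' Ψ ⊆ D.realRoots := by
    rw [← hreal, ← e.image_real]
    exact Set.image_mono hΨ
  rw [← e.isMaximalRootSubsystem_image_iff, hreal]
  exact AffRefl.ExtensionDatum.isMaximalRootSubsystem_realRoots_iff hE hA hB hsub
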